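/- There is an absolute constant $C>0$ such that the following holds. Let $m,n\ge 1$, and let $a_1,\dots,a_m$ be independent random vectors in $\mathbb R^n$ whose coordinates are i.i.d. copies of a symmetric random variable $a$ of unit variance with finite sub-gaussian norm $\kappa=\sup_{p\ge 1}p^{-1/2}(\mathbb E|a|^p)^{1/p}$. Let $K\subseteq\mathbb R^n$ be contained in the Euclidean unit ball, and let $w(K)=\mathbb E\sup_{z\in K-K}\langle g,z\rangle$ be its Gaussian mean width, where $g$ is a standard Gaussian vector in $\mathbb R^n$. Fix $x\in K$ with $\|x\|_2=1$. Let $\theta:\mathbb R\to[-1,1]$ be measurable with $\lambda:=\mathbb E\,\theta(g_0)g_0>0$, where $g_0\sim N(0,1)$. Let $y=(y_1,\dots,y_m)$ follow the generalized linear model: each $y_i$ takes values in $\{-1,1\}$, the $y_i$ are conditionally independent given $(a_1,\dots,a_m)$, and $\mathbb E(y_i\mid a_1,\dots,a_m)=\theta(\langle a_i,x\rangle)$ almost surely for every $i$. Put $$f_x(x')=\frac1m\sum_{i=1}^m y_i\langle a_i,x'\rangle .$$ Let $\alpha>0$ and suppose that $|\mathbb E f_x(x')-\lambda\langle x,x'\rangle|\le\alpha$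 for every $x'\in K$. Then for every $\beta>0$, there is an event of probability at least $1-4e^{-\beta^2}$ on which every solution $\hat x$ of the problem $$\max\ \sum_{i=1}^m y_i\langle a_i,x'\rangle\quad\text{subject to}\quad x'\in K$$ satisfies $$\|\hat x-x\|_2^2\le\frac{4\alpha}{\lambda}+C\kappa\,\frac{w(K)+\beta}{\lambda\sqrt m}.$$ -/

import Mathlib

open MeasureTheory ProbabilityTheory
open scoped Pointwise ENNReal

noncomputable section

namespace OneBit

/-- The sub-gaussian norm `κ = sup_{p ≥ 1} p^{-1/2} (E |X|^p)^{1/p}`, as an extended nonnegative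
real; `X` is sub-gaussian if this is finite. Here `eLpNorm X p P = (E |X|^p)^{1/p}`. -/
def subgaussianNorm {Ω : Type*} [MeasurableSpace Ω] (X : Ω → ℝ) (P : Measure Ω) : ℝ≥0∞ :=
  ⨆ (p : ℝ) (_ : 1 ≤ p), ENNReal.ofReal (p ^ (-(1 / 2) : ℝ)) * eLpNorm X (ENNReal.ofReal p) P

/-- The Gaussian mean width `w(K) = E sup_{z ∈ K - K} ⟨g, z⟩`, where `g` is a standard Gaussian
vector in `ℝⁿ`. -/
def meanWidth {n : ℕ} (K : Set (EuclideanSpace ℝ (Fin n))) : ℝ :=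
  ∫ g, (⨆ z : (K - K : Set (EuclideanSpace ℝ (Fin n))),
    inner ℝ g (z : EuclideanSpace ℝ (Fin n))) ∂(stdGaussian (EuclideanSpace ℝ (Fin n)))

/-- The correlation parameter `λ = E θ(g) g`, where `g ∼ N(0,1)`. -/
def corr (θ : ℝ → ℝ) : ℝ := ∫ t, θ t * t ∂(gaussianReal 0 1)

/-- `a₁, …, a_m` are independent random vectors in `ℝⁿ` whose coordinates are independent copies
of the random variable `ξ`, which is symmetric, sub-gaussian and of unit variance. -/
structure IsSubgaussianEnsemble {Ω Ω' : Type*} [MeasurableSpace Ω] [MeasurableSpace Ω']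
    (μ : Measure Ω) (P : Measure Ω') (ξ : Ω' → ℝ) {m n : ℕ}
    (a : Fin m → Ω → EuclideanSpace ℝ (Fin n)) : Prop where
  symmetric : IdentDistrib ξ (-ξ) P P
  unit_variance : Var[ξ; P] = 1
  subgaussian : subgaussianNorm ξ P < ∞
  measurable : ∀ i, Measurable (a i)
  copies : ∀ i j, IdentDistrib (fun ω => a i ω j) ξ μ P
  indep : iIndepFun (fun (ij : Fin m × Fin n) ω => a ij.1 ω ij.2) μ

/-- The σ-algebra generated by the measurement vectors `a₁, …, a_m`. -/
abbrev sigmaAlg {Ω : Type*} {m n : ℕ} (a : Fin m → Ω → EuclideanSpace ℝ (Fin n)) :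
    MeasurableSpace Ω :=
  MeasurableSpace.comap (fun ω i => a i ω) MeasurableSpace.pi

/-- Conditional independence of the family `y` given the σ-algebra `𝒢`: the conditional
probabilities of intersections factorize almost surely. (This is the characterization
`iCondIndepFun_iff_condExp_inter_preimage_eq_mul` of Mathlib's `iCondIndepFun`, which is only available when `Ω` is
standard Borel.) -/
def CondIndepGiven {Ω : Type*} [MeasurableSpace Ω] (μ : Measure Ω) (𝒢 : MeasurableSpace Ω)
    {m : ℕ} (y : Fin m → Ω → ℝ) : Prop :=
  ∀ (s : Finset (Fin m)) (B : Fin m → Set ℝ), (∀ i, MeasurableSet (B i)) →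
    μ[(⋂ i ∈ s, y i ⁻¹' B i).indicator (fun _ => (1 : ℝ)) | 𝒢]
      =ᵐ[μ] ∏ i ∈ s, μ[(y i ⁻¹' B i).indicator (fun _ => (1 : ℝ)) | 𝒢]

/-- The generalized linear model: the `y i` take values in `{-1, 1}`, are conditionally
independent given the measurement vectors, and have conditional mean `θ(⟨a i, x⟩)` given
the measurement vectors. -/
structure IsGLM {Ω : Type*} [MeasurableSpace Ω] (μ : Measure Ω) {m n : ℕ}
    (a : Fin m → Ω → EuclideanSpace ℝ (Fin n)) (θ : ℝ → ℝ) (x : EuclideanSpace ℝ (Fin n))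
    (y : Fin m → Ω → ℝ) : Prop where
  measurable : ∀ i, Measurable (y i)
  values : ∀ i ω, y i ω = -1 ∨ y i ω = 1
  cond_indep : CondIndepGiven μ (sigmaAlg a) y
  cond_mean : ∀ i, μ[y i | sigmaAlg a] =ᵐ[μ] fun ω => θ (inner ℝ (a i ω) x)

/-- The rescaled objective function `f_x(x') = (1/m) ∑ y_i ⟨a_i, x'⟩` at the outcome `ω`. -/
def objective {Ω : Type*} {m n : ℕ} (a : Fin m → Ω → EuclideanSpace ℝ (Fin n))
    (y : Fin m → Ω → ℝ) (x' : EuclideanSpace ℝ (Fin n)) (ω : Ω) : ℝ :=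
  (1 / (m : ℝ)) * ∑ i, y i ω * inner ℝ (a i ω) x'

/-- `xhat` solves the program: maximize `∑ y_i ⟨a_i, x'⟩` subject to `x' ∈ K`, at the
outcome `ω`. -/
def IsSolution {Ω : Type*} {m n : ℕ} (a : Fin m → Ω → EuclideanSpace ℝ (Fin n))
    (y : Fin m → Ω → ℝ) (K : Set (EuclideanSpace ℝ (Fin n))) (ω : Ω)
    (xhat : EuclideanSpace ℝ (Fin n)) : Prop :=
  xhat ∈ K ∧ IsMaxOn (fun x' => ∑ i, y i ω * inner ℝ (a i ω) x') K xhat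

end OneBit

end

/-! Write `V i = y i • a i`, `W = ∑ i, (V i - E V i)`, `T = K - K`, and let `supportFun T` be the
support function of `T`. The analytic part of the error bound is deterministic. Since `xhat`
maximizes the objective and `xhat - x` lies in `T`, the expected objective drops by at most
`supportFun T W / m` from `x` to `xhat`. The hypothesis on the expectation turns this into `λ(1 -
⟨x, xhat⟩) ≤ 2α + supportFun T W / m`, and `‖xhat - x‖² ≤ 2(1 - ⟨x, xhat⟩)` because `x` is a unit
vector and `K` lies in the unit ball. It remains to bound `supportFun T W` with high probability,
which is done by comparing `W` with a Gaussian vector in the convex order. A symmetric sub-gaussian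
variable is dominated by a Gaussian dilated by a constant times `κ` (`ConvexLE.of_subgaussianNorm`).
The domination passes to vectors coordinate by coordinate, survives multiplication by a sign and
centering at the cost of a factor 2 (`ConvexLE.centered_of_sign`), and adds up over independent
terms. The independence needed is that of the pairs `(a i, y i)` (`IsGLM.iIndepFun_prodMk`). So `W`
is dominated by a dilated standard Gaussian. Exponentials of the support function are convex, so the
Gaussian Laplace bound `integral_exp_supportFun_le` and Markov's inequality finish. -/

namespace OneBit

/-! ### Convex order: images, convolutions, independent sums -/

/-- The convex order, tested on nonnegative continuous convex functions. -/
def ConvexLE {E : Type*} [NormedAddCommGroup E] [NormedSpace ℝ E] [MeasurableSpace E]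
    (μ ν : Measure E) : Prop :=
  ∀ F : E → ℝ, ConvexOn ℝ Set.univ F → Continuous F → (∀ v, 0 ≤ F v) →
    ∫⁻ v, ENNReal.ofReal (F v) ∂μ ≤ ∫⁻ v, ENNReal.ofReal (F v) ∂ν

namespace ConvexLE

variable {E G : Type*} [NormedAddCommGroup E] [NormedSpace ℝ E] [MeasurableSpace E] [BorelSpace E]
  [NormedAddCommGroup G] [NormedSpace ℝ G] [MeasurableSpace G] [BorelSpace G]

lemma map {μ ν : Measure E} (h : ConvexLE μ ν) (A : E →L[ℝ] G) :
    ConvexLE (μ.map A) (ν.map A) := by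
  intro F h1 h2 h3
  have hm : Measurable fun v => ENNReal.ofReal (F v) := h2.measurable.ennreal_ofReal
  rw [lintegral_map hm A.continuous.measurable, lintegral_map hm A.continuous.measurable]
  exact h (F ∘ A) (h1.comp_linearMap A.toLinearMap) (h2.comp A.continuous) fun v => h3 _

/-- With one summand frozen, the test function is still convex in the other, so the two laws can be
replaced one at a time. Test functions are nonnegative, so Tonelli applies without any
integrability. -/
lemma conv [SecondCountableTopology E] {μ₁ ν₁ μ₂ ν₂ : Measure E} [SFinite μ₁] [SFinite ν₁]
    [SFinite μ₂] [SFinite ν₂] (h₁ : ConvexLE μ₁ ν₁) (h₂ : ConvexLE μ₂ ν₂) :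
    ConvexLE (μ₁ ∗ μ₂) (ν₁ ∗ ν₂) := by
  intro F hF hc h0
  have hm : Measurable fun v => ENNReal.ofReal (F v) := hc.measurable.ennreal_ofReal
  have hm2 : Measurable fun p : E × E => ENNReal.ofReal (F (p.1 + p.2)) :=
    hm.comp measurable_add
  have tr : ∀ u, ConvexOn ℝ Set.univ fun v => F (u + v) := fun u => by
    simpa [Function.comp_def] using hF.translate_right u
  rw [Measure.lintegral_conv hm, Measure.lintegral_conv hm]
  calc ∫⁻ u, ∫⁻ v, ENNReal.ofReal (F (u + v)) ∂μ₂ ∂μ₁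
      ≤ ∫⁻ u, ∫⁻ v, ENNReal.ofReal (F (u + v)) ∂ν₂ ∂μ₁ :=
        lintegral_mono fun u => h₂ _ (tr u) (by fun_prop) fun v => h0 _
    _ = ∫⁻ v, ∫⁻ u, ENNReal.ofReal (F (v + u)) ∂μ₁ ∂ν₂ := by
        rw [lintegral_lintegral_swap hm2.aemeasurable]
        simp only [add_comm]
    _ ≤ ∫⁻ v, ∫⁻ u, ENNReal.ofReal (F (v + u)) ∂ν₁ ∂ν₂ :=
        lintegral_mono fun u => h₁ _ (tr u) (by fun_prop) fun v => h0 _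
    _ = ∫⁻ u, ∫⁻ v, ENNReal.ofReal (F (u + v)) ∂ν₂ ∂ν₁ := by
        rw [lintegral_lintegral_swap hm2.aemeasurable]
        simp only [add_comm]

lemma sum [SecondCountableTopology E] {Ω Ω' ι : Type*} [MeasurableSpace Ω] [MeasurableSpace Ω']
    {μ : Measure Ω} {ν : Measure Ω'} [IsProbabilityMeasure μ] [IsProbabilityMeasure ν]
    {X : ι → Ω → E} {Y : ι → Ω' → E} (hX : ∀ i, Measurable (X i)) (hY : ∀ i, Measurable (Y i))
    (hXi : iIndepFun X μ) (hYi : iIndepFun Y ν)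
    (h : ∀ i, ConvexLE (μ.map (X i)) (ν.map (Y i))) (s : Finset ι) :
    ConvexLE (μ.map (fun ω => ∑ i ∈ s, X i ω)) (ν.map (fun ω => ∑ i ∈ s, Y i ω)) := by
  classical
  induction s using Finset.induction_on with
  | empty => intro F _ _ _; simp
  | insert i s hi ih =>
    have e1 : (fun ω => ∑ j ∈ insert i s, X j ω) = (fun ω => ∑ j ∈ s, X j ω) + X i := by
      ext ω; simp [Finset.sum_insert hi, add_comm]
    have e2 : (fun ω => ∑ j ∈ insert i s, Y j ω) = (fun ω => ∑ j ∈ s, Y j ω) + Y i := by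
      ext ω; simp [Finset.sum_insert hi, add_comm]
    have m1 : Measurable fun ω => ∑ j ∈ s, X j ω := by fun_prop
    have m2 : Measurable fun ω => ∑ j ∈ s, Y j ω := by fun_prop
    have i1 : IndepFun (fun ω => ∑ j ∈ s, X j ω) (X i) μ := by
      have := hXi.indepFun_finsetSum_of_notMem hX hi
      convert this using 1; ext ω; simp
    have i2 : IndepFun (fun ω => ∑ j ∈ s, Y j ω) (Y i) ν := by
      have := hYi.indepFun_finsetSum_of_notMem hY hi
      convert this using 1; ext ω; simp
    rw [e1, e2, i1.map_add_eq_map_conv_map m1 (hX i), i2.map_add_eq_map_conv_map m2 (hY i)]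
    exact ih.conv (h i)

end ConvexLE

/-! ### Contraction principle on the line -/

lemma exists_superlevel_eq_of_even_monotone {ψ : ℝ → ℝ} (hc : Continuous ψ)
    (he : ∀ x, ψ (-x) = ψ x) (hm : MonotoneOn ψ (Set.Ici 0)) {t : ℝ} (h0 : ψ 0 ≤ t) :
    {x | t < ψ x} = ∅ ∨ ∃ r, 0 ≤ r ∧ {x | t < ψ x} = {x | r < |x|} := by
  have habs : ∀ x, ψ |x| = ψ x := fun x => by
    rcases abs_cases x with ⟨h, _⟩ | ⟨h, _⟩ <;> rw [h]
    exact he x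
  by_cases hb : ∃ b, t < ψ b
  · right
    obtain ⟨b, hb⟩ := hb
    set S := {x | 0 ≤ x ∧ ψ x ≤ t} with hS
    have hcl : IsClosed S := (isClosed_Ici (a := (0 : ℝ))).inter (isClosed_le hc continuous_const)
    have hne : S.Nonempty := ⟨0, le_refl _, h0⟩
    have hbd : BddAbove S := ⟨|b|, fun x hx => by
      by_contra hlt
      push Not at hlt
      have := hm (abs_nonneg b) hx.1 hlt.le
      rw [habs] at this
      exact absurd (hb.trans_le (this.trans hx.2)) (lt_irrefl _)⟩
    have hmem := hcl.csSup_mem hne hbd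
    refine ⟨sSup S, hmem.1, ?_⟩
    ext x
    simp only [Set.mem_ofPred_eq]
    constructor
    · intro hx
      by_contra hle
      push Not at hle
      have := hm (abs_nonneg x) hmem.1 hle
      rw [habs] at this
      exact absurd (hx.trans_le (this.trans hmem.2)) (lt_irrefl _)
    · intro hx
      by_contra hle
      push Not at hle
      exact absurd (le_csSup hbd ⟨abs_nonneg x, (habs x).trans_le hle⟩) (not_le.2 hx)
  · left
    push Not at hb
    ext x
    simpa using hb x

/-- Layer-cake formula: every superlevel set of `ψ` is empty or of the form `r < |x|`, exactly the
sets on which the tails are compared. -/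
lemma lintegral_le_of_tail_le {ρ γ : Measure ℝ} {K c : ℝ}
    (htail : ∀ t, 0 ≤ t → ρ {x | t < |x|} ≤ ENNReal.ofReal K * γ {x | t < |c * x|})
    {ψ : ℝ → ℝ} (hc : Continuous ψ) (hpos : ∀ x, 0 ≤ ψ x) (h0 : ψ 0 = 0)
    (he : ∀ x, ψ (-x) = ψ x) (hm : MonotoneOn ψ (Set.Ici 0)) :
    ∫⁻ x, ENNReal.ofReal (ψ x) ∂ρ ≤
      ENNReal.ofReal K * ∫⁻ x, ENNReal.ofReal (ψ (c * x)) ∂γ := by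
  rw [lintegral_eq_lintegral_meas_lt ρ (Filter.Eventually.of_forall hpos)
      hc.measurable.aemeasurable,
    lintegral_eq_lintegral_meas_lt γ (Filter.Eventually.of_forall fun x => hpos (c * x))
      (by fun_prop), ← lintegral_const_mul' _ _ ENNReal.ofReal_ne_top]
  refine setLIntegral_mono' measurableSet_Ioi fun t ht => ?_
  rcases exists_superlevel_eq_of_even_monotone hc he hm (t := t) (h0.trans_le (le_of_lt ht))
    with h | ⟨r, hr, h⟩
  · rw [h]; simp
  · have h' : {x | t < ψ (c * x)} = {x | r < |c * x|} := by
      ext x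
      exact Set.ext_iff.1 h (c * x)
    rw [h, h']
    exact htail r hr

lemma lintegral_symmetrize {ρ : Measure ℝ} (hs : ρ.map (fun x => -x) = ρ) {F : ℝ → ℝ}
    (hF : Continuous F) (h0 : ∀ x, 0 ≤ F x) :
    ∫⁻ x, ENNReal.ofReal (F x) ∂ρ = ∫⁻ x, ENNReal.ofReal ((F x + F (-x)) / 2) ∂ρ := by
  have hm : Measurable fun v => ENNReal.ofReal (F v) := hF.measurable.ennreal_ofReal
  have h1 : ∫⁻ x, ENNReal.ofReal (F (-x)) ∂ρ = ∫⁻ x, ENNReal.ofReal (F x) ∂ρ := by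
    conv_rhs => rw [← hs]
    rw [lintegral_map hm measurable_neg]
  have h2 : ∀ x, ENNReal.ofReal ((F x + F (-x)) / 2) =
      ENNReal.ofReal (1 / 2) * (ENNReal.ofReal (F x) + ENNReal.ofReal (F (-x))) := fun x => by
    rw [← ENNReal.ofReal_add (h0 _) (h0 _), ← ENNReal.ofReal_mul (by norm_num)]
    congr 1; ring
  simp_rw [h2]
  rw [lintegral_const_mul' _ _ ENNReal.ofReal_ne_top, lintegral_add_left hm, h1, ← two_mul,
    ← mul_assoc]
  have : ENNReal.ofReal (1 / 2) * 2 = 1 := by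
    rw [show (2 : ℝ≥0∞) = ENNReal.ofReal 2 by simp, ← ENNReal.ofReal_mul (by norm_num)]
    norm_num
  rw [this, one_mul]

/-- The contraction principle in dimension one: a symmetric law whose tail is dominated, up to a
factor, by the tail of a second symmetric law, is dominated in the convex order by a dilation of
the latter. -/
lemma ConvexLE.of_tail_le {ρ γ : Measure ℝ} [IsProbabilityMeasure ρ] [IsProbabilityMeasure γ]
    (hρ : ρ.map (fun x => -x) = ρ) (hγ : γ.map (fun x => -x) = γ) {K c : ℝ} (hK : 1 ≤ K)
    (htail : ∀ t, 0 ≤ t → ρ {x | t < |x|} ≤ ENNReal.ofReal K * γ {x | t < |c * x|}) :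
    ConvexLE ρ (γ.map (fun x => K * (c * x))) := by
  intro F hF hc h0
  have hK0 : 0 < K := by linarith
  have hm : Measurable fun v => ENNReal.ofReal (F v) := hc.measurable.ennreal_ofReal
  rw [lintegral_map hm (by fun_prop), lintegral_symmetrize hρ hc h0,
    lintegral_symmetrize hγ (F := fun x => F (K * (c * x))) (by fun_prop) fun x => h0 _]
  -- Both laws are symmetric, so `F` may be replaced by its even part, which is convex and hence
  -- increasing on the half-line.
  set φ : ℝ → ℝ := fun x => (F x + F (-x)) / 2 with hφ
  have hφc : Continuous φ := by fun_prop
  have hφe : ∀ x, φ (-x) = φ x := fun x => by simp [hφ, add_comm]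
  have hφ0 : ∀ x, 0 ≤ φ x := fun x => by have := h0 x; have := h0 (-x); simp only [hφ]; positivity
  have hφconv : ConvexOn ℝ Set.univ φ := by
    have h1 : ConvexOn ℝ Set.univ fun x => F (-x) := by
      simpa [Function.comp_def] using hF.comp_linearMap (-LinearMap.id : ℝ →ₗ[ℝ] ℝ)
    have h2 : φ = fun x => (1 / 2 : ℝ) • (F + fun x => F (-x)) x := by
      ext x
      simp only [hφ, Pi.add_apply, smul_eq_mul]
      ring
    rw [h2]
    exact (hF.add h1).smul (by norm_num)
  have hφm : MonotoneOn φ (Set.Ici 0) := by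
    intro x hx y hy hxy
    have hx' : (0 : ℝ) ≤ x := hx
    have := hφconv.le_max_of_mem_Icc (Set.mem_univ (-y)) (Set.mem_univ y) (z := x)
      ⟨by linarith, hxy⟩
    simpa [hφe] using this
  set ψ : ℝ → ℝ := fun x => φ (K * x) - φ 0 with hψ
  have hψm : MonotoneOn ψ (Set.Ici 0) := fun x hx y hy hxy => by
    have hx' : (0 : ℝ) ≤ x := hx
    have hy' : (0 : ℝ) ≤ y := hy
    exact sub_le_sub_right (hφm (Set.mem_Ici.2 (by positivity)) (Set.mem_Ici.2 (by positivity))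
      (by gcongr)) _
  have hψe : ∀ x, ψ (-x) = ψ x := fun x => by simp [hψ, hφe]
  have hψ0 : ∀ x, 0 ≤ ψ x := fun x => by
    have h1 : ψ x = ψ |x| := by
      rcases abs_cases x with ⟨h, _⟩ | ⟨h, _⟩ <;> rw [h]
      exact (hψe x).symm
    have h2 : ψ 0 ≤ ψ |x| := hψm (Set.mem_Ici.2 le_rfl) (abs_nonneg x) (abs_nonneg x)
    rw [h1]
    simpa [hψ] using h2
  -- Convexity between `0` and `K x` gains a factor `K⁻¹`, which absorbs the factor `K` lost in the
  -- tail comparison.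
  have hle : ∀ x, φ x ≤ φ 0 + K⁻¹ * ψ x := fun x => by
    have := hφconv.2 (Set.mem_univ (K * x)) (Set.mem_univ 0)
      (show (0 : ℝ) ≤ K⁻¹ by positivity) (show (0 : ℝ) ≤ 1 - K⁻¹ by
        rw [sub_nonneg]; exact inv_le_one_of_one_le₀ hK) (by ring)
    simp only [smul_eq_mul, mul_zero, add_zero] at this
    rw [inv_mul_cancel_left₀ hK0.ne'] at this
    simp only [hψ]
    linarith
  calc ∫⁻ x, ENNReal.ofReal (φ x) ∂ρ
      ≤ ∫⁻ x, (ENNReal.ofReal (φ 0) + ENNReal.ofReal K⁻¹ * ENNReal.ofReal (ψ x)) ∂ρ := by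
        refine lintegral_mono fun x => ?_
        rw [← ENNReal.ofReal_mul (by positivity), ← ENNReal.ofReal_add (hφ0 0)
          (mul_nonneg (by positivity) (hψ0 x))]
        exact ENNReal.ofReal_le_ofReal (hle x)
    _ = ENNReal.ofReal (φ 0) + ENNReal.ofReal K⁻¹ * ∫⁻ x, ENNReal.ofReal (ψ x) ∂ρ := by
        rw [lintegral_add_left measurable_const, lintegral_const_mul' _ _ ENNReal.ofReal_ne_top]
        simp
    _ ≤ ENNReal.ofReal (φ 0) + ENNReal.ofReal K⁻¹ *
          (ENNReal.ofReal K * ∫⁻ x, ENNReal.ofReal (ψ (c * x)) ∂γ) := by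
        gcongr
        exact lintegral_le_of_tail_le htail (by fun_prop) hψ0 (by simp [hψ]) hψe hψm
    _ = ENNReal.ofReal (φ 0) + ∫⁻ x, ENNReal.ofReal (ψ (c * x)) ∂γ := by
        rw [← mul_assoc, ← ENNReal.ofReal_mul (by positivity), inv_mul_cancel₀ hK0.ne']
        simp
    _ = ∫⁻ x, ENNReal.ofReal (φ (K * (c * x))) ∂γ := by
        rw [← one_mul (ENNReal.ofReal (φ 0)), ← measure_univ (μ := γ), mul_comm,
          ← lintegral_const, ← lintegral_add_left measurable_const]
        refine lintegral_congr fun x => ?_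
        rw [← ENNReal.ofReal_add (hφ0 0) (hψ0 _)]
        simp [hψ]
    _ ≤ _ := by
        refine le_of_eq (lintegral_congr fun x => ?_)
        simp [hφ]

/-! ### Comparison of sub-gaussian and Gaussian tails -/

lemma eLpNorm_le_subgaussianNorm {Ω : Type*} [MeasurableSpace Ω] {P : Measure Ω} {ξ : Ω → ℝ}
    (hfin : subgaussianNorm ξ P < ∞) {p : ℝ} (hp : 1 ≤ p) :
    eLpNorm ξ (ENNReal.ofReal p) P ≤
      ENNReal.ofReal ((subgaussianNorm ξ P).toReal * p ^ (1 / 2 : ℝ)) := by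
  have hp0 : 0 < p := by linarith
  have h : ENNReal.ofReal (p ^ (-(1 / 2) : ℝ)) * eLpNorm ξ (ENNReal.ofReal p) P ≤
      subgaussianNorm ξ P := le_iSup₂_of_le p hp le_rfl
  rw [ENNReal.ofReal_mul ENNReal.toReal_nonneg, ENNReal.ofReal_toReal hfin.ne]
  calc eLpNorm ξ (ENNReal.ofReal p) P
      = (ENNReal.ofReal (p ^ (-(1 / 2) : ℝ)) * eLpNorm ξ (ENNReal.ofReal p) P) *
          ENNReal.ofReal (p ^ (1 / 2 : ℝ)) := by
        rw [mul_right_comm, ← ENNReal.ofReal_mul (by positivity), ← Real.rpow_add hp0]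
        simp
    _ ≤ _ := by gcongr

lemma measure_lt_abs_le_of_subgaussianNorm {Ω : Type*} [MeasurableSpace Ω] {P : Measure Ω}
    [IsProbabilityMeasure P] {ξ : Ω → ℝ} (hξ : AEMeasurable ξ P)
    (hfin : subgaussianNorm ξ P < ∞) (hpos : 0 < (subgaussianNorm ξ P).toReal) {t : ℝ}
    (ht : 0 ≤ t) :
    P {ω | t < |ξ ω|} ≤
      ENNReal.ofReal (Real.exp (1 - (t / (Real.exp 1 * (subgaussianNorm ξ P).toReal)) ^ 2)) := by
  set κ := (subgaussianNorm ξ P).toReal with hκ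
  set r := t / (Real.exp 1 * κ) with hr
  have hr0 : 0 ≤ r := by positivity
  rcases le_or_gt r 1 with h | h
  · refine prob_le_one.trans ?_
    rw [ENNReal.one_le_ofReal]
    exact Real.one_le_exp (by nlinarith)
  -- Markov's inequality with exponent `p = r²`, chosen so that `κ √p / t = e⁻¹`. The extra `1` in
  -- the exponent of the bound covers the case `r ≤ 1`, where this `p` need not be admissible.
  · have hp : 1 ≤ r ^ 2 := by nlinarith
    have htr : t = r * (Real.exp 1 * κ) := by rw [hr]; field_simp
    have htpos : 0 < t := by rw [htr]; positivity
    have hch := meas_ge_le_mul_pow_eLpNorm_enorm P (p := ENNReal.ofReal (r ^ 2))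
      (ε := ENNReal.ofReal t)
      (by rw [ne_eq, ENNReal.ofReal_eq_zero]; linarith) ENNReal.ofReal_ne_top hξ.aestronglyMeasurable
      (by simpa using htpos) (fun h => absurd h ENNReal.ofReal_ne_top)
    rw [ENNReal.toReal_ofReal (by positivity)] at hch
    calc P {ω | t < |ξ ω|} ≤ P {ω | ENNReal.ofReal t ≤ ‖ξ ω‖ₑ} := by
          refine measure_mono fun ω hω => ?_
          rw [Set.mem_ofPred_eq, Real.enorm_eq_ofReal_abs]
          exact ENNReal.ofReal_le_ofReal (le_of_lt hω)
      _ ≤ _ := hch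
      _ ≤ (ENNReal.ofReal t)⁻¹ ^ (r ^ 2) * (ENNReal.ofReal (κ * (r ^ 2) ^ (1 / 2 : ℝ))) ^ (r ^ 2) := by
          gcongr
          exact eLpNorm_le_subgaussianNorm hfin hp
      _ = ENNReal.ofReal ((t⁻¹ * (κ * r)) ^ (r ^ 2)) := by
          rw [← Real.sqrt_eq_rpow, Real.sqrt_sq hr0, ← ENNReal.ofReal_inv_of_pos htpos,
            ENNReal.ofReal_rpow_of_pos (by positivity), ENNReal.ofReal_rpow_of_pos (by positivity),
            ← ENNReal.ofReal_mul (by positivity), 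
            ← Real.mul_rpow (by positivity) (by positivity)]
      _ ≤ _ := by
          refine ENNReal.ofReal_le_ofReal ?_
          have : t⁻¹ * (κ * r) = Real.exp (-1) := by
            rw [htr, Real.exp_neg]; field_simp
          rw [this, ← Real.exp_mul]
          exact Real.exp_le_exp.2 (by linarith)

/-- Only the mass of `(t, t + 1]` is kept; there `x² / 2 ≤ (t + 1)² / 2 ≤ t² + 1`. -/
lemma le_gaussianReal_lt_abs {t : ℝ} (ht : 0 ≤ t) :
    ENNReal.ofReal ((√(2 * Real.pi))⁻¹ * Real.exp (-1 - t ^ 2)) ≤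
      gaussianReal 0 1 {x | t < |x|} := by
  calc ENNReal.ofReal ((√(2 * Real.pi))⁻¹ * Real.exp (-1 - t ^ 2))
      = ∫⁻ _ in Set.Ioc t (t + 1), ENNReal.ofReal ((√(2 * Real.pi))⁻¹ * Real.exp (-1 - t ^ 2)) := by
        simp
    _ ≤ ∫⁻ x in Set.Ioc t (t + 1), gaussianPDF 0 1 x := by
        refine setLIntegral_mono' measurableSet_Ioc fun x hx => ?_
        rw [gaussianPDF]
        refine ENNReal.ofReal_le_ofReal ?_
        simp only [gaussianPDFReal, NNReal.coe_one, mul_one, sub_zero]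
        gcongr
        have h1 : x ^ 2 ≤ (t + 1) ^ 2 := by
          have := hx.1; have := hx.2; gcongr; linarith
        nlinarith [sq_nonneg (t - 1)]
    _ = gaussianReal 0 1 (Set.Ioc t (t + 1)) := (gaussianReal_apply 0 one_ne_zero _).symm
    _ ≤ _ := measure_mono fun x hx => lt_of_lt_of_le hx.1 (le_abs_self x)

lemma ConvexLE.of_subgaussianNorm {Ω : Type*} [MeasurableSpace Ω] {P : Measure Ω}
    [IsProbabilityMeasure P] {ξ : Ω → ℝ} (hξ : AEMeasurable ξ P) (hsymm : IdentDistrib ξ (-ξ) P P)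
    (hfin : subgaussianNorm ξ P < ∞) (hpos : 0 < (subgaussianNorm ξ P).toReal) :
    ConvexLE (P.map ξ) ((gaussianReal 0 1).map
      (fun x => 27 * ((Real.exp 1 * (subgaussianNorm ξ P).toReal) * x))) := by
  have := Measure.isProbabilityMeasure_map hξ
  -- The constant 27 bounds the ratio of the two tail estimates, `e² √(2π) ≤ 9 · 3`.
  refine ConvexLE.of_tail_le ?_ ?_ (by norm_num) fun t ht => ?_
  · rw [AEMeasurable.map_map_of_aemeasurable (by fun_prop) hξ]
    exact hsymm.map_eq.symm
  · rw [gaussianReal_map_neg, neg_zero]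
  · set κ := (subgaussianNorm ξ P).toReal with hκ
    have hc : 0 < Real.exp 1 * κ := by positivity
    rw [Measure.map_apply_of_aemeasurable hξ (measurableSet_lt (by fun_prop) (by fun_prop))]
    have hset : {x : ℝ | t < |Real.exp 1 * κ * x|} = {x | t / (Real.exp 1 * κ) < |x|} := by
      ext x
      rw [Set.mem_ofPred_eq, Set.mem_ofPred_eq, abs_mul, abs_of_pos hc, div_lt_iff₀' hc]
    rw [hset]
    refine (measure_lt_abs_le_of_subgaussianNorm hξ hfin hpos ht).trans ?_
    refine le_trans ?_ (mul_le_mul_right (le_gaussianReal_lt_abs (by positivity)) _)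
    rw [← ENNReal.ofReal_mul (by norm_num)]
    refine ENNReal.ofReal_le_ofReal ?_
    set r := t / (Real.exp 1 * κ)
    have e1 : Real.exp (1 - r ^ 2) = Real.exp 1 * Real.exp 1 * Real.exp (-1 - r ^ 2) := by
      rw [← Real.exp_add, ← Real.exp_add]; congr 1; ring
    have h3 : Real.exp 1 < 3 := Real.exp_one_lt_three
    have hpi : √(2 * Real.pi) ≤ 3 := by
      rw [Real.sqrt_le_left (by norm_num)]; nlinarith [Real.pi_lt_d2]
    have hinv : 1 / 3 ≤ (√(2 * Real.pi))⁻¹ := by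
      rw [one_div]; exact inv_anti₀ (by positivity) hpi
    rw [e1, ← mul_assoc]
    refine mul_le_mul_of_nonneg_right ?_ (Real.exp_pos _).le
    nlinarith [Real.exp_pos 1]

lemma subgaussianNorm_toReal_pos {Ω : Type*} [MeasurableSpace Ω] {P : Measure Ω}
    [IsProbabilityMeasure P] {ξ : Ω → ℝ} (hξ : AEMeasurable ξ P)
    (hfin : subgaussianNorm ξ P < ∞) (hvar : Var[ξ; P] = 1) :
    0 < (subgaussianNorm ξ P).toReal := by
  refine lt_of_le_of_ne ENNReal.toReal_nonneg fun h => ?_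
  have h1 := eLpNorm_le_subgaussianNorm hfin (p := 1) le_rfl
  rw [← h, zero_mul, ENNReal.ofReal_zero, nonpos_iff_eq_zero,
    eLpNorm_eq_zero_iff hξ.aestronglyMeasurable (by simp)] at h1
  rw [variance_congr h1] at hvar
  simp at hvar

/-! ### Vectors, symmetrization and Gaussian sums -/

lemma ConvexLE.of_coordinates {Ω : Type*} [MeasurableSpace Ω] {μ : Measure Ω}
    [IsProbabilityMeasure μ] {n : ℕ} {a : Ω → EuclideanSpace ℝ (Fin n)} (ha : Measurable a)
    (hind : iIndepFun (fun j ω => a ω j) μ) {L : ℝ}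
    (h : ∀ j, ConvexLE (μ.map fun ω => a ω j) ((gaussianReal 0 1).map fun x => L * x)) :
    ConvexLE (μ.map a) ((stdGaussian (EuclideanSpace ℝ (Fin n))).map fun v => L • v) := by
  set b := EuclideanSpace.basisFun (Fin n) ℝ
  have hcoord : ∀ j, Measurable fun ω => a ω j := fun j => by fun_prop
  have hsum := ConvexLE.sum (μ := μ) (ν := Measure.pi fun _ : Fin n => gaussianReal 0 1)
    (X := fun j ω => a ω j • b j) (Y := fun j x => (L * x j) • b j)
    (fun j => (hcoord j).smul_const _) (fun j => by fun_prop)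
    (hind.comp (fun j x => x • b j) fun j => by fun_prop)
    (iIndepFun_pi (X := fun j x => (L * x) • b j) fun j => by fun_prop)
    (fun j => by
      have := (h j).map (ContinuousLinearMap.toSpanSingleton ℝ (b j))
      rw [Measure.map_map (by fun_prop) (hcoord j), Measure.map_map (by fun_prop) (by fun_prop),
        ← (measurePreserving_eval (fun _ : Fin n => gaussianReal 0 1) j).map_eq,
        Measure.map_map (by fun_prop) (by fun_prop)] at this
      exact this) Finset.univ
  convert hsum using 1
  · congr 1
    ext1 ω
    exact (b.sum_repr (a ω)).symm
  · rw [stdGaussian_eq_map_pi_orthonormalBasis b, Measure.map_map (by fun_prop) (by fun_prop)]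
    congr 1
    ext1 x
    simp [Finset.smul_sum, mul_smul]

lemma stdGaussian_map_neg {E : Type*} [NormedAddCommGroup E] [InnerProductSpace ℝ E]
    [FiniteDimensional ℝ E] [MeasurableSpace E] [BorelSpace E] :
    (stdGaussian E).map (fun v => -v) = stdGaussian E :=
  stdGaussian_map (LinearIsometryEquiv.neg ℝ)

lemma ofReal_apply_integral_le {E : Type*} [NormedAddCommGroup E] [NormedSpace ℝ E]
    [CompleteSpace E] {Ω : Type*} [MeasurableSpace Ω] {μ : Measure Ω} [IsProbabilityMeasure μ]
    {F : E → ℝ} (hF : ConvexOn ℝ Set.univ F) (hc : Continuous F) (h0 : ∀ v, 0 ≤ F v) {X : Ω → E}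
    (hX : Integrable X μ) :
    ENNReal.ofReal (F (∫ ω, X ω ∂μ)) ≤ ∫⁻ ω, ENNReal.ofReal (F (X ω)) ∂μ := by
  by_cases hi : Integrable (F ∘ X) μ
  · change _ ≤ ∫⁻ ω, ENNReal.ofReal ((F ∘ X) ω) ∂μ
    rw [← ofReal_integral_eq_lintegral_ofReal hi (Filter.Eventually.of_forall fun ω => h0 _)]
    exact ENNReal.ofReal_le_ofReal
      (hF.map_integral_le hc.continuousOn isClosed_univ (by simp) hX hi)
  · have : ∫⁻ ω, ENNReal.ofReal (F (X ω)) ∂μ = ∞ := by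
      by_contra hne
      refine hi ⟨hc.comp_aestronglyMeasurable hX.1, ?_⟩
      rw [hasFiniteIntegral_iff_ofReal (f := F ∘ X) (Filter.Eventually.of_forall fun ω => h0 _)]
      exact lt_top_iff_ne_top.2 hne
    rw [this]
    exact le_top

/-- Symmetrization: if `V = y a` with a random sign `y` and `a` is dominated by a symmetric law
`γ`, then `V - E V` is dominated by the dilation of `γ` by the factor `2`. -/
lemma ConvexLE.centered_of_sign {E : Type*} [NormedAddCommGroup E] [NormedSpace ℝ E]
    [CompleteSpace E] [SecondCountableTopology E]
    [MeasurableSpace E] [BorelSpace E] {Ω : Type*} [MeasurableSpace Ω] {μ : Measure Ω}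
    [IsProbabilityMeasure μ] {γ : Measure E} (hγ : γ.map (fun v => -v) = γ) {a : Ω → E}
    (ha : Measurable a) (hint : Integrable a μ) (h : ConvexLE (μ.map a) γ) {y : Ω → ℝ}
    (hy : Measurable y) (hval : ∀ ω, y ω = -1 ∨ y ω = 1) :
    ConvexLE (μ.map fun ω => y ω • a ω - ∫ ω', y ω' • a ω' ∂μ) (γ.map fun v => (2 : ℝ) • v) := by
  intro F hF hc h0
  have hm : Measurable fun v => ENNReal.ofReal (F v) := hc.measurable.ennreal_ofReal
  set V : Ω → E := fun ω => y ω • a ω with hV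
  have hVm : Measurable V := hy.smul ha
  have hVi : Integrable V μ := by
    refine hint.mono hVm.aestronglyMeasurable (Filter.Eventually.of_forall fun ω => ?_)
    rcases hval ω with h | h <;> simp [hV, h]
  have hneg : ConvexOn ℝ Set.univ fun v => F ((-2 : ℝ) • v) := by
    simpa [Function.comp_def] using hF.comp_linearMap ((-2 : ℝ) • (LinearMap.id : E →ₗ[ℝ] E))
  have hdbl : ConvexOn ℝ Set.univ fun v => F ((2 : ℝ) • v) := by
    simpa [Function.comp_def] using hF.comp_linearMap ((2 : ℝ) • (LinearMap.id : E →ₗ[ℝ] E))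
  have hsub : ∀ u, ConvexOn ℝ Set.univ fun v => F (u - v) := fun u => by
    have h1 := hF.translate_right u
    have h2 := h1.comp_linearMap (-(LinearMap.id : E →ₗ[ℝ] E))
    simpa [Function.comp_def, sub_eq_add_neg] using h2
  have hhalf : ∀ u v, ENNReal.ofReal (F (u - v)) ≤
      2⁻¹ * ENNReal.ofReal (F ((2 : ℝ) • u)) + 2⁻¹ * ENNReal.ofReal (F ((-2 : ℝ) • v)) := by
    intro u v
    have := hF.2 (Set.mem_univ ((2 : ℝ) • u)) (Set.mem_univ ((-2 : ℝ) • v))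
      (show (0 : ℝ) ≤ 2⁻¹ by norm_num) (show (0 : ℝ) ≤ 2⁻¹ by norm_num) (by norm_num)
    have e : (2⁻¹ : ℝ) • (2 : ℝ) • u + (2⁻¹ : ℝ) • (-2 : ℝ) • v = u - v := by
      rw [smul_smul, smul_smul]; norm_num [sub_eq_add_neg]
    rw [e] at this
    have h2 : (2⁻¹ : ℝ≥0∞) = ENNReal.ofReal 2⁻¹ := by
      rw [ENNReal.ofReal_inv_of_pos (by norm_num)]; simp
    rw [h2, ← ENNReal.ofReal_mul (by norm_num), ← ENNReal.ofReal_mul (by norm_num),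
      ← ENNReal.ofReal_add (mul_nonneg (by norm_num) (h0 _)) (mul_nonneg (by norm_num) (h0 _))]
    exact ENNReal.ofReal_le_ofReal this
  have hm2 : Measurable fun ω => ENNReal.ofReal (F ((2 : ℝ) • V ω)) := by fun_prop
  have hm3 : Measurable fun ω => ENNReal.ofReal (F ((2 : ℝ) • a ω)) := by fun_prop
  -- Jensen's inequality replaces the mean by an independent copy of `V`; convexity then separates
  -- the two copies.
  have key1 : ∫⁻ ω, ENNReal.ofReal (F (V ω - ∫ ω', V ω' ∂μ)) ∂μ ≤
      2⁻¹ * ∫⁻ ω, ENNReal.ofReal (F ((2 : ℝ) • V ω)) ∂μ +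
        2⁻¹ * ∫⁻ ω, ENNReal.ofReal (F ((-2 : ℝ) • V ω)) ∂μ := by
    calc ∫⁻ ω, ENNReal.ofReal (F (V ω - ∫ ω', V ω' ∂μ)) ∂μ
        ≤ ∫⁻ ω, (2⁻¹ * ENNReal.ofReal (F ((2 : ℝ) • V ω)) +
            2⁻¹ * ∫⁻ ω', ENNReal.ofReal (F ((-2 : ℝ) • V ω')) ∂μ) ∂μ := by
          refine lintegral_mono fun ω => ?_
          refine (ofReal_apply_integral_le (hsub (V ω)) (by fun_prop) (fun _ => h0 _) hVi).trans ?_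
          refine (lintegral_mono fun ω' => hhalf (V ω) (V ω')).trans_eq ?_
          rw [lintegral_add_left measurable_const, lintegral_const, measure_univ, mul_one,
            lintegral_const_mul' _ _ (by simp)]
      _ = _ := by
          rw [lintegral_add_right _ measurable_const, lintegral_const_mul' _ _ (by simp)]
          simp
  -- The sign only permutes the two terms at each outcome, so no independence of `y` and `a` is
  -- required.
  have key2 : 2⁻¹ * ∫⁻ ω, ENNReal.ofReal (F ((2 : ℝ) • V ω)) ∂μ +
        2⁻¹ * ∫⁻ ω, ENNReal.ofReal (F ((-2 : ℝ) • V ω)) ∂μ =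
      2⁻¹ * ∫⁻ ω, ENNReal.ofReal (F ((2 : ℝ) • a ω)) ∂μ +
        2⁻¹ * ∫⁻ ω, ENNReal.ofReal (F ((-2 : ℝ) • a ω)) ∂μ := by
    rw [← mul_add, ← mul_add, ← lintegral_add_left hm2, ← lintegral_add_left hm3]
    congr 1
    refine lintegral_congr fun ω => ?_
    rcases hval ω with h | h
    · simp [hV, h, add_comm]
    · simp [hV, h]
  have hγ2 : ∫⁻ v, ENNReal.ofReal (F ((-2 : ℝ) • v)) ∂γ = ∫⁻ v, ENNReal.ofReal (F ((2 : ℝ) • v)) ∂γ := by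
    conv_lhs => rw [← hγ]
    rw [lintegral_map (by fun_prop) (by fun_prop)]
    simp
  have g1 := h _ hdbl (by fun_prop) fun v => h0 _
  have g2 := h _ hneg (by fun_prop) fun v => h0 _
  rw [lintegral_map (by fun_prop) ha] at g1 g2
  rw [hγ2] at g2
  rw [lintegral_map hm (hVm.sub_const _), lintegral_map hm (by fun_prop)]
  refine key1.trans (key2.trans_le ?_)
  refine (add_le_add (mul_le_mul_right g1 _) (mul_le_mul_right g2 _)).trans_eq ?_
  rw [← add_mul, ENNReal.inv_two_add_inv_two, one_mul]

lemma map_sum_stdGaussian {n m : ℕ} (L : ℝ) :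
    (Measure.pi fun _ : Fin m => stdGaussian (EuclideanSpace ℝ (Fin n))).map
        (fun g => ∑ i, L • g i) =
      (stdGaussian (EuclideanSpace ℝ (Fin n))).map fun v => (L * √m) • v := by
  set γ := stdGaussian (EuclideanSpace ℝ (Fin n))
  refine Measure.ext_of_charFun ?_
  ext t
  have hi : iIndepFun (fun (i : Fin m) (g : Fin m → EuclideanSpace ℝ (Fin n)) => L • g i)
      (Measure.pi fun _ : Fin m => γ) :=
    iIndepFun_pi (X := fun _ v => L • v) fun i => by fun_prop
  have hmap : ∀ i : Fin m, (Measure.pi fun _ : Fin m => γ).map (fun g => L • g i) =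
      γ.map fun v => L • v := fun i => by
    conv_rhs => rw [← (measurePreserving_eval (fun _ : Fin m => γ) i).map_eq,
      Measure.map_map (by fun_prop) (by fun_prop)]
    rfl
  have hmeas : ∀ i : Fin m, Measurable fun g : Fin m → EuclideanSpace ℝ (Fin n) => L • g i :=
    fun i => by fun_prop
  rw [hi.charFun_map_fun_sum_eq_prod fun i => (hmeas i).aemeasurable]
  simp only [Finset.prod_apply, hmap, charFun_map_smul, γ, charFun_stdGaussian,
    Finset.prod_const, Finset.card_univ, Fintype.card_fin]
  have hsq : (‖(L * √m) • t‖) ^ 2 = m * ‖L • t‖ ^ 2 := by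
    rw [norm_smul, norm_smul, norm_mul, Real.norm_of_nonneg (Real.sqrt_nonneg _), mul_pow, mul_pow,
      mul_pow, Real.sq_sqrt (Nat.cast_nonneg m)]
    ring
  rw [← Complex.exp_nat_mul, ← Complex.ofReal_pow, ← Complex.ofReal_pow, hsq]
  push_cast
  congr 1
  ring

/-! ### Support functions of bounded sets -/

section SupportFunction

variable {E : Type*} [NormedAddCommGroup E] [InnerProductSpace ℝ E]

/-- The support function `v ↦ sup_{z ∈ T} ⟨v, z⟩` of a set. -/
noncomputable def supportFun (T : Set E) (v : E) : ℝ := ⨆ z : T, inner ℝ v (z : E)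

variable {T : Set E} {R : ℝ}

lemma bddAbove_range_inner (hR : ∀ z ∈ T, ‖z‖ ≤ R) (v : E) :
    BddAbove (Set.range fun z : T => inner ℝ v (z : E)) :=
  ⟨‖v‖ * R, by
    rintro _ ⟨z, rfl⟩
    exact (real_inner_le_norm _ _).trans (by gcongr; exact hR z z.2)⟩

lemma inner_le_supportFun (hR : ∀ z ∈ T, ‖z‖ ≤ R) (v : E) {z : E} (hz : z ∈ T) :
    inner ℝ v z ≤ supportFun T v :=
  le_ciSup (bddAbove_range_inner hR v) ⟨z, hz⟩

lemma supportFun_le (h0 : (0 : E) ∈ T) {v : E} {B : ℝ} (h : ∀ z ∈ T, inner ℝ v z ≤ B) :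
    supportFun T v ≤ B := by
  have : Nonempty T := ⟨⟨0, h0⟩⟩
  exact ciSup_le fun z => h z z.2

lemma supportFun_nonneg (hR : ∀ z ∈ T, ‖z‖ ≤ R) (h0 : (0 : E) ∈ T) (v : E) :
    0 ≤ supportFun T v := by
  simpa using inner_le_supportFun hR v h0

lemma supportFun_le_norm (hR : ∀ z ∈ T, ‖z‖ ≤ R) (h0 : (0 : E) ∈ T) (v : E) :
    supportFun T v ≤ R * ‖v‖ :=
  supportFun_le h0 fun z hz => (real_inner_le_norm _ _).trans (by
    rw [mul_comm]; gcongr; exact hR z hz)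

lemma supportFun_add_le (hR : ∀ z ∈ T, ‖z‖ ≤ R) (h0 : (0 : E) ∈ T) (u v : E) :
    supportFun T (u + v) ≤ supportFun T u + supportFun T v :=
  supportFun_le h0 fun z hz => by
    rw [inner_add_left]
    exact add_le_add (inner_le_supportFun hR u hz) (inner_le_supportFun hR v hz)

lemma supportFun_smul {c : ℝ} (hc : 0 ≤ c) (v : E) :
    supportFun T (c • v) = c * supportFun T v := by
  simp only [supportFun, real_inner_smul_left]
  exact (Real.mul_iSup_of_nonneg hc _).symm

lemma convexOn_supportFun (hR : ∀ z ∈ T, ‖z‖ ≤ R) (h0 : (0 : E) ∈ T) :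
    ConvexOn ℝ Set.univ (supportFun T) := by
  refine ⟨convex_univ, fun u _ v _ a b ha hb _ => ?_⟩
  rw [smul_eq_mul, smul_eq_mul, ← supportFun_smul ha, ← supportFun_smul hb]
  exact supportFun_add_le hR h0 _ _

lemma continuous_supportFun (hR : ∀ z ∈ T, ‖z‖ ≤ R) (h0 : (0 : E) ∈ T) :
    Continuous (supportFun T) := by
  refine (LipschitzWith.of_le_add_mul (Real.toNNReal R) fun u v => ?_).continuous
  have h1 := supportFun_add_le hR h0 v (u - v)
  rw [add_sub_cancel] at h1
  refine h1.trans ?_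
  rw [dist_eq_norm, Real.coe_toNNReal R (by simpa using hR 0 h0)]
  gcongr
  exact supportFun_le_norm hR h0 _

end SupportFunction

/-! ### Gaussian concentration by rotation -/

section Concentration

variable {E : Type*} [NormedAddCommGroup E] [InnerProductSpace ℝ E] [FiniteDimensional ℝ E]
  [MeasurableSpace E] [BorelSpace E]

lemma integrable_exp_mul_norm_stdGaussian (r : ℝ) :
    Integrable (fun v => Real.exp (r * ‖v‖)) (stdGaussian E) := by
  obtain ⟨C, hC, h⟩ := IsGaussian.exists_integrable_exp_sq (stdGaussian E)
  refine (h.const_mul (Real.exp (r ^ 2 / (4 * C)))).mono' (by fun_prop)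
    (Filter.Eventually.of_forall fun v => ?_)
  rw [Real.norm_of_nonneg (Real.exp_pos _).le, ← Real.exp_add]
  refine Real.exp_le_exp.2 ?_
  have h1 : r ^ 2 / (4 * C) + C * ‖v‖ ^ 2 - r * ‖v‖ = (r - 2 * C * ‖v‖) ^ 2 / (4 * C) := by
    field_simp; ring
  have : 0 ≤ (r - 2 * C * ‖v‖) ^ 2 / (4 * C) := by positivity
  linarith

lemma lintegral_exp_inner_stdGaussian (t : ℝ) (z : E) :
    ∫⁻ v, ENNReal.ofReal (Real.exp (t * inner ℝ v z)) ∂(stdGaussian E) =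
      ENNReal.ofReal (Real.exp (t ^ 2 * ‖z‖ ^ 2 / 2)) := by
  have hmap : (stdGaussian E).map (innerSL ℝ z) = gaussianReal 0 (‖z‖ ^ 2).toNNReal := by
    rw [IsGaussian.map_eq_gaussianReal, integral_strongDual_stdGaussian,
      variance_dual_stdGaussian, innerSL_apply_norm]
  have hint : Integrable (fun v => Real.exp (t * inner ℝ v z)) (stdGaussian E) := by
    refine (integrable_exp_mul_norm_stdGaussian (|t| * ‖z‖)).mono' (by fun_prop)
      (Filter.Eventually.of_forall fun v => ?_)
    rw [Real.norm_of_nonneg (Real.exp_pos _).le]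
    refine Real.exp_le_exp.2 ((le_abs_self _).trans ?_)
    rw [abs_mul, mul_assoc, mul_comm ‖z‖]
    gcongr
    exact abs_real_inner_le_norm _ _
  rw [← ofReal_integral_eq_lintegral_ofReal hint
    (Filter.Eventually.of_forall fun v => (Real.exp_pos _).le)]
  have := mgf_gaussianReal hmap t
  rw [mgf] at this
  simp only [innerSL_apply_apply, zero_mul, zero_add, Real.coe_toNNReal _ (sq_nonneg ‖z‖)] at this
  simp_rw [real_inner_comm z, this]
  congr 2
  ring

variable {T : Set E} {R : ℝ}

lemma integrable_exp_supportFun (hR : ∀ z ∈ T, ‖z‖ ≤ R) (h0 : (0 : E) ∈ T) (s : ℝ) :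
    Integrable (fun v => Real.exp (s * supportFun T v)) (stdGaussian E) := by
  have hc := continuous_supportFun hR h0
  refine (integrable_exp_mul_norm_stdGaussian (|s| * R)).mono'
    (by fun_prop) (Filter.Eventually.of_forall fun v => ?_)
  rw [Real.norm_of_nonneg (Real.exp_pos _).le]
  refine Real.exp_le_exp.2 ((le_abs_self _).trans ?_)
  rw [abs_mul, mul_assoc, abs_of_nonneg (supportFun_nonneg hR h0 v)]
  gcongr
  exact supportFun_le_norm hR h0 v

lemma integrable_supportFun (hR : ∀ z ∈ T, ‖z‖ ≤ R) (h0 : (0 : E) ∈ T) :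
    Integrable (supportFun T) (stdGaussian E) := by
  refine ((IsGaussian.integrable_id (μ := stdGaussian E)).norm.const_mul R).mono'
    (continuous_supportFun hR h0).aestronglyMeasurable (Filter.Eventually.of_forall fun v => ?_)
  rw [Real.norm_of_nonneg (supportFun_nonneg hR h0 v)]
  exact supportFun_le_norm hR h0 v

/-- A near-maximizer `z` for `u` gives `supportFun T ((u + v) / √2) ≥ (supportFun T u - η + ⟨v, z⟩)
/ √2`, so only the Laplace transform of the Gaussian variable `⟨v, z⟩` is needed. The supremum need
not be attained, hence the limit `η → 0`. -/
lemma lintegral_exp_supportFun_sub_le (hR : ∀ z ∈ T, ‖z‖ ≤ R) (h0 : (0 : E) ∈ T) {s : ℝ}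
    (hs : 0 ≤ s) (u : E) :
    ∫⁻ v, ENNReal.ofReal (Real.exp
        (2 * s * (supportFun T u - supportFun T ((√2 / 2) • (u + v))))) ∂(stdGaussian E) ≤
      ENNReal.ofReal (Real.exp (s ^ 2 * R ^ 2)) *
        ENNReal.ofReal (Real.exp ((2 - √2) * s * supportFun T u)) := by
  have : Nonempty T := ⟨⟨0, h0⟩⟩
  rw [← ENNReal.ofReal_mul (Real.exp_pos _).le, ← Real.exp_add]
  have hlim : Filter.Tendsto (fun η : ℝ => ENNReal.ofReal (Real.exp
      (s ^ 2 * R ^ 2 + (2 - √2) * s * supportFun T u + √2 * s * η))) (nhdsWithin 0 (Set.Ioi 0))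
      (nhds (ENNReal.ofReal (Real.exp (s ^ 2 * R ^ 2 + (2 - √2) * s * supportFun T u)))) := by
    have : Continuous fun η : ℝ => ENNReal.ofReal (Real.exp
      (s ^ 2 * R ^ 2 + (2 - √2) * s * supportFun T u + √2 * s * η)) :=
      ENNReal.continuous_ofReal.comp (by fun_prop)
    simpa using (this.tendsto 0).mono_left nhdsWithin_le_nhds
  refine ge_of_tendsto hlim (eventually_nhdsWithin_of_forall fun η hη => ?_)
  obtain ⟨⟨z, hz⟩, hzη⟩ := exists_lt_of_lt_ciSup
    (show supportFun T u - η < ⨆ z : T, inner ℝ u (z : E) from sub_lt_self _ hη)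
  have hz2 : ‖z‖ ^ 2 ≤ R ^ 2 := by gcongr; exact hR z hz
  calc _ ≤ ∫⁻ v, ENNReal.ofReal (Real.exp ((2 - √2) * s * supportFun T u + √2 * s * η)) *
          ENNReal.ofReal (Real.exp (-(√2 * s) * inner ℝ v z)) ∂(stdGaussian E) := by
        refine lintegral_mono fun v => ?_
        rw [← ENNReal.ofReal_mul (Real.exp_pos _).le, ← Real.exp_add]
        refine ENNReal.ofReal_le_ofReal (Real.exp_le_exp.2 ?_)
        have h1 := inner_le_supportFun hR ((√2 / 2) • (u + v)) hz
        rw [real_inner_smul_left, inner_add_left] at h1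
        have h2 : √2 / 2 * (supportFun T u - η + inner ℝ v z) ≤
            supportFun T ((√2 / 2) • (u + v)) := by
          refine le_trans ?_ h1
          gcongr
        nlinarith [mul_le_mul_of_nonneg_left h2 hs]
    _ ≤ _ := by
        rw [lintegral_const_mul' _ _ ENNReal.ofReal_ne_top, lintegral_exp_inner_stdGaussian,
          ← ENNReal.ofReal_mul (Real.exp_pos _).le, ← Real.exp_add]
        refine ENNReal.ofReal_le_ofReal (Real.exp_le_exp.2 ?_)
        have h2 : (-(√2 * s)) ^ 2 = 2 * s ^ 2 := by
          rw [neg_sq, mul_pow, Real.sq_sqrt (by norm_num)]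
        rw [h2]
        nlinarith [mul_le_mul_of_nonneg_left hz2 (sq_nonneg s)]

/-- For independent Gaussians `u`, `v`, the difference of the support function at `u` and at `v` is
split at the midpoint `(u + v) / √2` of a rotation. By `ab ≤ (a² + b²) / 2` and rotation invariance,
both halves reduce to the preceding estimate. -/
lemma integral_exp_mul_exp_neg_le (hR : ∀ z ∈ T, ‖z‖ ≤ R) (h0 : (0 : E) ∈ T) {s : ℝ}
    (hs : 0 ≤ s) :
    (∫ v, Real.exp (s * supportFun T v) ∂(stdGaussian E)) *
        ∫ v, Real.exp (-s * supportFun T v) ∂(stdGaussian E) ≤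
      Real.exp (s ^ 2 * R ^ 2) *
        ∫ v, Real.exp ((2 - √2) * s * supportFun T v) ∂(stdGaussian E) := by
  have hc := continuous_supportFun hR h0
  set γ := stdGaussian E
  set c : ℝ := √2 / 2
  have hc2 : c * c = 2⁻¹ := by
    rw [show c * c = √2 ^ 2 / 4 by ring, Real.sq_sqrt (by norm_num)]; norm_num
  set H : E × E → ℝ≥0∞ := fun p => ENNReal.ofReal (Real.exp
    (2 * s * (supportFun T p.1 - supportFun T (c • (p.1 + p.2))))) with hH
  have hHm : Measurable H := by fun_prop
  have hJ : ∫⁻ p, H p ∂(γ.prod γ) ≤ ENNReal.ofReal (Real.exp (s ^ 2 * R ^ 2) *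
        ∫ v, Real.exp ((2 - √2) * s * supportFun T v) ∂γ) := by
    rw [lintegral_prod _ hHm.aemeasurable]
    refine (lintegral_mono fun u => lintegral_exp_supportFun_sub_le hR h0 hs u).trans_eq ?_
    rw [lintegral_const_mul' _ _ ENNReal.ofReal_ne_top, ENNReal.ofReal_mul (Real.exp_pos _).le,
      ofReal_integral_eq_lintegral_ofReal (integrable_exp_supportFun hR h0 _)
        (Filter.Eventually.of_forall fun v => (Real.exp_pos _).le)]
  have hrot : ∫⁻ p, ENNReal.ofReal (Real.exp
      (2 * s * (supportFun T (c • (p.1 + p.2)) - supportFun T p.2))) ∂(γ.prod γ) =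
      ∫⁻ p, H p ∂(γ.prod γ) := by
    conv_rhs => rw [← IsGaussian.map_rotation_eq_self (μ := γ) integral_id_stdGaussian
      (Real.pi / 4), lintegral_map hHm (by fun_prop)]
    refine lintegral_congr fun p => ?_
    simp only [hH, ContinuousLinearMap.rotation_apply, Real.cos_pi_div_four,
      Real.sin_pi_div_four]
    have e1 : c • p.1 + c • p.2 = c • (p.1 + p.2) := (smul_add _ _ _).symm
    have e2 : c • (c • p.1 + c • p.2 + (-c • p.1 + c • p.2)) = p.2 := by
      have : c • p.1 + c • p.2 + (-c • p.1 + c • p.2) = (2 * c) • p.2 := by module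
      rw [this, smul_smul, show c * (2 * c) = 2 * (c * c) by ring, hc2]
      norm_num
    rw [e2, e1]
  have hi := fun t => integrable_exp_supportFun hR h0 t (E := E)
  refine (ENNReal.ofReal_le_ofReal_iff (mul_nonneg (Real.exp_pos _).le
    (integral_nonneg fun v => (Real.exp_pos _).le))).1 ?_
  refine le_trans ?_ hJ
  rw [ENNReal.ofReal_mul (integral_nonneg fun v => (Real.exp_pos _).le),
    ofReal_integral_eq_lintegral_ofReal (hi _)
      (Filter.Eventually.of_forall fun v => (Real.exp_pos _).le),
    ofReal_integral_eq_lintegral_ofReal (hi _)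
      (Filter.Eventually.of_forall fun v => (Real.exp_pos _).le),
    ← lintegral_prod_mul (by fun_prop) (by fun_prop)]
  have h2 : (2⁻¹ : ℝ≥0∞) = ENNReal.ofReal 2⁻¹ := by
    rw [ENNReal.ofReal_inv_of_pos (by norm_num)]; simp
  calc _ ≤ ∫⁻ p, (2⁻¹ * H p + 2⁻¹ * ENNReal.ofReal (Real.exp
      (2 * s * (supportFun T (c • (p.1 + p.2)) - supportFun T p.2)))) ∂(γ.prod γ) := by
        refine lintegral_mono fun p => ?_
        rw [h2, hH, ← ENNReal.ofReal_mul (Real.exp_pos _).le, ← ENNReal.ofReal_mul (by norm_num),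
          ← ENNReal.ofReal_mul (by norm_num), ← ENNReal.ofReal_add (by positivity) (by positivity)]
        refine ENNReal.ofReal_le_ofReal ?_
        set A := s * (supportFun T p.1 - supportFun T (c • (p.1 + p.2))) with hA
        set B := s * (supportFun T (c • (p.1 + p.2)) - supportFun T p.2) with hB
        have e1 : Real.exp (s * supportFun T p.1) * Real.exp (-s * supportFun T p.2) =
            Real.exp A * Real.exp B := by
          rw [← Real.exp_add, ← Real.exp_add, hA, hB]; congr 1; ring
        have e2 : 2 * s * (supportFun T p.1 - supportFun T (c • (p.1 + p.2))) = A + A := by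
          rw [hA]; ring
        have e3 : 2 * s * (supportFun T (c • (p.1 + p.2)) - supportFun T p.2) = B + B := by
          rw [hB]; ring
        rw [e1, e2, e3, Real.exp_add, Real.exp_add]
        nlinarith [sq_nonneg (Real.exp A - Real.exp B)]
    _ = 2⁻¹ * ∫⁻ p, H p ∂(γ.prod γ) + 2⁻¹ * ∫⁻ p, H p ∂(γ.prod γ) := by
        rw [lintegral_add_left (by fun_prop), lintegral_const_mul' _ _ (by simp),
          lintegral_const_mul' _ _ (by simp), hrot]
    _ = _ := by rw [← add_mul, ENNReal.inv_two_add_inv_two, one_mul]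

/-- Gaussian concentration, in Laplace transform form, for the supremum of a bounded family of
linear functionals. -/
lemma integral_exp_supportFun_le (hR : ∀ z ∈ T, ‖z‖ ≤ R) (h0 : (0 : E) ∈ T) {s : ℝ}
    (hs : 0 ≤ s) :
    ∫ v, Real.exp (s * supportFun T v) ∂(stdGaussian E) ≤
      Real.exp (3 * (s * ∫ v, supportFun T v ∂(stdGaussian E) + s ^ 2 * R ^ 2)) := by
  have hc := continuous_supportFun hR h0
  set γ := stdGaussian E
  set w := ∫ v, supportFun T v ∂γ with hw
  have hw0 : 0 ≤ w := integral_nonneg fun v => supportFun_nonneg hR h0 v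
  set M := ∫ v, Real.exp (s * supportFun T v) ∂γ with hM
  have hi := fun t => integrable_exp_supportFun hR h0 t (E := E)
  have hM1 : 1 ≤ M := by
    have : ∫ _, (1 : ℝ) ∂γ ≤ M := integral_mono (integrable_const _) (hi s) fun v =>
      Real.one_le_exp (mul_nonneg hs (supportFun_nonneg hR h0 v))
    simpa using this
  have hM0 : 0 < M := by linarith
  have hJ1 : Real.exp (-s * w) ≤ ∫ v, Real.exp (-s * supportFun T v) ∂γ := by
    have := convexOn_exp.map_integral_le (μ := γ) (f := fun v => -s * supportFun T v)
      Real.continuous_exp.continuousOn isClosed_univ (by simp)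
      ((integrable_supportFun hR h0).const_mul _) (hi (-s))
    rwa [integral_const_mul] at this
  have ht0 : 0 ≤ 2 - √2 := by
    have : √2 ≤ 2 := by rw [Real.sqrt_le_left (by norm_num)]; norm_num
    linarith
  have ht1 : 2 - √2 ≤ 3 / 5 := by
    have : 7 / 5 ≤ √2 := Real.le_sqrt_of_sq_le (by norm_num)
    linarith
  have hJ2 : ∫ v, Real.exp ((2 - √2) * s * supportFun T v) ∂γ ≤ M ^ (2 - √2) := by
    have e : ∀ v, Real.exp ((2 - √2) * s * supportFun T v) =
        (fun x : ℝ => x ^ (2 - √2)) (Real.exp (s * supportFun T v)) := fun v => by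
      simp only [← Real.exp_mul]; congr 1; ring
    simp_rw [e]
    refine ConcaveOn.le_map_integral (s := Set.Ici 0) (f := fun v => Real.exp (s * supportFun T v))
      (Real.concaveOn_rpow ht0 (by linarith))
      (Real.continuous_rpow_const ht0).continuousOn isClosed_Ici
      (Filter.Eventually.of_forall fun v => (Real.exp_pos _).le) (hi s) ?_
    exact (hi ((2 - √2) * s)).congr (Filter.Eventually.of_forall e)
  have hmain := integral_exp_mul_exp_neg_le hR h0 hs
  have h1 : M * Real.exp (-s * w) ≤ Real.exp (s ^ 2 * R ^ 2) * M ^ (2 - √2) :=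
    (mul_le_mul_of_nonneg_left hJ1 hM0.le).trans
      (hmain.trans (mul_le_mul_of_nonneg_left hJ2 (Real.exp_pos _).le))
  have h2 := Real.log_le_log (by positivity) h1
  rw [Real.log_mul hM0.ne' (Real.exp_pos _).ne', Real.log_mul (Real.exp_pos _).ne'
    (Real.rpow_pos_of_pos hM0 _).ne', Real.log_exp, Real.log_exp, Real.log_rpow hM0] at h2
  rw [← Real.log_le_iff_le_exp hM0]
  have hl : 0 ≤ Real.log M := Real.log_nonneg hM1
  have h3 : 0 ≤ s * w := mul_nonneg hs hw0
  have h4 : 0 ≤ s ^ 2 * R ^ 2 := by positivity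
  -- The two Jensen bounds give `(√2 - 1) log M ≤ s w + s² R²`, and `√2 - 1 ≥ 2/5`, so `3` is more
  -- than enough.
  nlinarith [mul_le_mul_of_nonneg_right ht1 hl]

end Concentration

/-! ### Independence in the generalized linear model -/

lemma iIndepFun_curry {ι κ Ω 𝓧 : Type*} [MeasurableSpace Ω] [MeasurableSpace 𝓧] {P : Measure Ω}
    {X : ι × κ → Ω → 𝓧} (mX : ∀ p, Measurable (X p)) (h : iIndepFun X P) :
    iIndepFun (fun i ω j => X (i, j) ω) P := by
  have := h.isProbabilityMeasure
  have : ∀ p, IsProbabilityMeasure (P.map (X p)) :=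
    fun p => Measure.isProbabilityMeasure_map (mX p).aemeasurable
  have : ∀ i, IsProbabilityMeasure (P.map fun ω j => X (i, j) ω) :=
    fun i => Measure.isProbabilityMeasure_map (Measurable.aemeasurable (by fun_prop))
  rw [iIndepFun_iff_map_fun_eq_infinitePi_map (by fun_prop)]
  have h1 := (iIndepFun_iff_map_fun_eq_infinitePi_map (by fun_prop)).1 h
  have h2 : ∀ i, P.map (fun ω j => X (i, j) ω) = Measure.infinitePi fun j => P.map (X (i, j)) :=
    fun i => (iIndepFun_iff_map_fun_eq_infinitePi_map (by fun_prop)).1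
      (h.precomp (g := fun j => (i, j)) fun j j' hj => (Prod.ext_iff.1 hj).2)
  simp_rw [h2]
  rw [← Measure.infinitePi_map_curry fun i j => P.map (X (i, j)), ← h1,
    Measure.map_map (by fun_prop) (by fun_prop)]
  rfl

section GLM

variable {Ω : Type*} [MeasurableSpace Ω] {μ : Measure Ω} [IsProbabilityMeasure μ] {m n : ℕ}
  {a : Fin m → Ω → EuclideanSpace ℝ (Fin n)} {θ : ℝ → ℝ} {x : EuclideanSpace ℝ (Fin n)}
  {y : Fin m → Ω → ℝ}

lemma sigmaAlg_le (ha : ∀ i, Measurable (a i)) : sigmaAlg a ≤ (inferInstance : MeasurableSpace Ω) :=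
  (measurable_pi_iff.2 ha).comap_le

/-- The conditional probability that a random sign with conditional mean `t` lies in `B`. -/
noncomputable def signProb (B : Set ℝ) (t : ℝ) : ℝ :=
  (B.indicator (fun _ => 1) 1 + B.indicator (fun _ => 1) (-1)) / 2 +
    (B.indicator (fun _ => 1) 1 - B.indicator (fun _ => 1) (-1)) / 2 * t

lemma IsGLM.condExp_indicator (hy : IsGLM μ a θ x y) (ha : ∀ i, Measurable (a i)) (i : Fin m)
    (B : Set ℝ) :
    μ[(y i ⁻¹' B).indicator (fun _ => (1 : ℝ)) | sigmaAlg a] =ᵐ[μ]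
      fun ω => signProb B (θ (inner ℝ (a i ω) x)) := by
  set c : ℝ := (B.indicator (fun _ => (1 : ℝ)) 1 + B.indicator (fun _ => (1 : ℝ)) (-1)) / 2
    with hc
  set d : ℝ := (B.indicator (fun _ => (1 : ℝ)) 1 - B.indicator (fun _ => (1 : ℝ)) (-1)) / 2
    with hd
  -- On `{-1, 1}` every function is affine, so the conditional mean determines the conditional law.
  have hind : (y i ⁻¹' B).indicator (fun _ => (1 : ℝ)) = (fun _ => c) + d • y i := by
    ext ω
    have h1 : (y i ⁻¹' B).indicator (fun _ => (1 : ℝ)) ω = B.indicator (fun _ => 1) (y i ω) := rfl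
    rw [h1, Pi.add_apply, Pi.smul_apply, smul_eq_mul, hc, hd]
    rcases hy.values i ω with h | h <;> rw [h] <;> ring
  have hyi : Integrable (y i) μ := by
    refine Integrable.of_bound (hy.measurable i).aestronglyMeasurable 1
      (Filter.Eventually.of_forall fun ω => ?_)
    rcases hy.values i ω with h | h <;> simp [h]
  rw [hind]
  filter_upwards [condExp_add (integrable_const c) (hyi.smul d) (sigmaAlg a),
    condExp_smul d (y i) (sigmaAlg a) (μ := μ), hy.cond_mean i] with ω h1 h2 h3
  rw [h1, Pi.add_apply, h2, Pi.smul_apply, h3, condExp_const (sigmaAlg_le ha)]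
  rfl

lemma IsGLM.measureReal_iInter (hy : IsGLM μ a θ x y) (ha : ∀ i, Measurable (a i))
    (s : Finset (Fin m)) {A : Fin m → Set (EuclideanSpace ℝ (Fin n))}
    (hA : ∀ i, MeasurableSet (A i)) {B : Fin m → Set ℝ} (hB : ∀ i, MeasurableSet (B i)) :
    μ.real (⋂ i ∈ s, (a i ⁻¹' A i ∩ y i ⁻¹' B i)) =
      ∫ ω, ∏ i ∈ s, (A i).indicator (fun v => signProb (B i) (θ (inner ℝ v x))) (a i ω) ∂μ := by
  classical
  set D := ⋂ i ∈ s, a i ⁻¹' A i with hD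
  set Y := ⋂ i ∈ s, y i ⁻¹' B i with hY
  have hDm : MeasurableSet[sigmaAlg a] D := by
    refine Finset.measurableSet_biInter s fun i _ => ?_
    exact ⟨(fun f => f i) ⁻¹' A i, measurable_pi_apply i (hA i), rfl⟩
  have hDm' : MeasurableSet D := sigmaAlg_le ha _ hDm
  have hYm : MeasurableSet Y :=
    Finset.measurableSet_biInter s fun i _ => hy.measurable i (hB i)
  have hDY : (⋂ i ∈ s, (a i ⁻¹' A i ∩ y i ⁻¹' B i)) = Y ∩ D := by
    ext ω
    simp only [hY, hD, Set.mem_iInter, Set.mem_inter_iff]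
    exact ⟨fun h => ⟨fun i hi => (h i hi).2, fun i hi => (h i hi).1⟩,
      fun h i hi => ⟨h.2 i hi, h.1 i hi⟩⟩
  calc μ.real (⋂ i ∈ s, (a i ⁻¹' A i ∩ y i ⁻¹' B i))
      = ∫ ω in D, Y.indicator (fun _ => (1 : ℝ)) ω ∂μ := by
        rw [hDY, integral_indicator hYm]
        simp [measureReal_restrict_apply, hYm]
    _ = ∫ ω in D, (μ[Y.indicator (fun _ => (1 : ℝ)) | sigmaAlg a]) ω ∂μ :=
        (setIntegral_condExp (sigmaAlg_le ha) ((integrable_const _).indicator hYm) hDm).symm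
    _ = ∫ ω in D, ∏ i ∈ s, signProb (B i) (θ (inner ℝ (a i ω) x)) ∂μ := by
        refine integral_congr_ae (ae_restrict_of_ae ?_)
        have hall : ∀ᵐ ω ∂μ, ∀ i, (μ[(y i ⁻¹' B i).indicator (fun _ => (1 : ℝ)) | sigmaAlg a]) ω =
            signProb (B i) (θ (inner ℝ (a i ω) x)) :=
          ae_all_iff.2 fun i => hy.condExp_indicator ha i (B i)
        filter_upwards [hy.cond_indep s B hB, hall] with ω h1 h2
        rw [h1, Finset.prod_apply]
        exact Finset.prod_congr rfl fun i _ => h2 i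
    _ = _ := by
        rw [← integral_indicator hDm']
        refine integral_congr_ae (Filter.Eventually.of_forall fun ω => ?_)
        by_cases hω : ω ∈ D
        · simp only [Set.indicator_of_mem hω]
          refine Finset.prod_congr rfl fun i hi => ?_
          have hia : a i ω ∈ A i := Set.mem_iInter₂.1 hω i hi
          rw [Set.indicator_of_mem hia]
        · simp only [Set.indicator_of_notMem hω]
          have : ∃ i ∈ s, a i ω ∉ A i := by
            simpa [hD] using hω
          obtain ⟨i, hi, hia⟩ := this
          exact (Finset.prod_eq_zero hi (Set.indicator_of_notMem hia _)).symm

/-- In the generalized linear model with independent measurement vectors, the pairs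
`(a i, y i)` are independent. -/
lemma IsGLM.iIndepFun_prodMk (hy : IsGLM μ a θ x y) (ha : ∀ i, Measurable (a i))
    (hθ : Measurable θ) (hind : iIndepFun a μ) :
    iIndepFun (fun i ω => (a i ω, y i ω)) μ := by
  classical
  have hpair : ∀ i, Measurable fun ω => (a i ω, y i ω) := fun i => (ha i).prodMk (hy.measurable i)
  -- Measurable rectangles generate the σ-algebra of each pair. On them, conditioning on the `a i`
  -- leaves a product of functions of the separate `a i`, which factorizes by their independence.
  let π : Fin m → Set (Set Ω) := fun i => {S | ∃ t ∈ Set.image2 (· ×ˢ ·)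
    {A : Set (EuclideanSpace ℝ (Fin n)) | MeasurableSet A} {B : Set ℝ | MeasurableSet B},
    (fun ω => (a i ω, y i ω)) ⁻¹' t = S}
  rw [iIndepFun_iff_iIndep]
  refine iIndepSets.iIndep (fun i => (hpair i).comap_le) π
    (fun i => isPiSystem_prod.comap _) (fun i => ?_) ?_
  · rw [← generateFrom_prod, MeasurableSpace.comap_generateFrom]
    rfl
  rw [iIndepSets_iff]
  intro s f hf
  have hf' : ∀ i, ∃ A B, MeasurableSet A ∧ MeasurableSet B ∧
      (i ∈ s → f i = a i ⁻¹' A ∩ y i ⁻¹' B) := by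
    intro i
    by_cases hi : i ∈ s
    · obtain ⟨_, ⟨A, hA, B, hB, rfl⟩, h⟩ := hf i hi
      exact ⟨A, B, hA, hB, fun _ => h.symm⟩
    · exact ⟨∅, ∅, .empty, .empty, fun h => absurd h hi⟩
  choose A B hA hB hfAB using hf'
  set h : Fin m → EuclideanSpace ℝ (Fin n) → ℝ := fun i =>
    (A i).indicator (fun v => signProb (B i) (θ (inner ℝ v x))) with hh
  have hhm : ∀ i, Measurable (h i) := fun i => by
    refine Measurable.indicator ?_ (hA i)
    unfold signProb
    fun_prop
  have hone : ∀ i ∈ s, μ.real (f i) = ∫ ω, h i (a i ω) ∂μ := fun i hi => by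
    have := hy.measureReal_iInter ha {i} hA hB
    simpa [hfAB i hi] using this
  have hall : μ.real (⋂ i ∈ s, f i) = ∏ i ∈ s, μ.real (f i) := by
    have e1 : (⋂ i ∈ s, f i) = ⋂ i ∈ s, (a i ⁻¹' A i ∩ y i ⁻¹' B i) :=
      Set.iInter₂_congr fun i hi => hfAB i hi
    rw [e1, hy.measureReal_iInter ha s hA hB, Finset.prod_congr rfl hone]
    have e2 := hind.integral_fun_prod_comp (f := fun i v => if i ∈ s then h i v else 1)
      (fun i => (ha i).aemeasurable) fun i => by
        by_cases hi : i ∈ s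
        · simpa [hi] using (hhm i).aestronglyMeasurable
        · simpa [hi] using aestronglyMeasurable_const
    have e3 : ∀ i, ∫ ω, (if i ∈ s then h i (a i ω) else 1) ∂μ =
        if i ∈ s then ∫ ω, h i (a i ω) ∂μ else 1 := fun i => by
      split_ifs <;> simp
    simp_rw [e3, Finset.prod_ite_mem, Finset.univ_inter] at e2
    exact e2
  have := congrArg ENNReal.ofReal hall
  rw [ENNReal.ofReal_prod_of_nonneg fun _ _ => measureReal_nonneg] at this
  simpa [ofReal_measureReal] using this

end GLM

/-! ### Tail bound for the centered sum -/

lemma measure_lt_supportFun_le {E : Type*} [NormedAddCommGroup E] [InnerProductSpace ℝ E]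
    [FiniteDimensional ℝ E] [MeasurableSpace E] [BorelSpace E] {Ω : Type*} [MeasurableSpace Ω]
    {μ : Measure Ω} {W : Ω → E} (hW : Measurable W) {b : ℝ} (hb : 0 < b)
    (h : ConvexLE (μ.map W) ((stdGaussian E).map fun v => b • v)) {T : Set E}
    (hR : ∀ z ∈ T, ‖z‖ ≤ 2) (h0 : (0 : E) ∈ T) {β : ℝ} (hβ : 0 < β) :
    μ {ω | b * (3 * (∫ v, supportFun T v ∂(stdGaussian E)) + 12 * β) < supportFun T (W ω)} ≤
      ENNReal.ofReal (Real.exp (-β ^ 2)) := by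
  have hc := continuous_supportFun hR h0
  set w := ∫ v, supportFun T v ∂(stdGaussian E) with hw
  -- With radius `2`, the Chernoff exponent is `12 s² - 12 s β`, minimal at `s = β / 2` with value
  -- `-3β²`.
  set s := β / 2 with hs
  have hs0 : 0 < s := by positivity
  set r := s / b with hr
  have hr0 : 0 < r := by positivity
  have hrb : r * b = s := div_mul_cancel₀ s hb.ne'
  set τ := b * (3 * w + 12 * β) with hτ
  have hconv : ConvexOn ℝ Set.univ fun v => Real.exp (r * supportFun T v) := by
    have h1 : ConvexOn ℝ Set.univ fun v => r * supportFun T v :=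
      (convexOn_supportFun hR h0).smul hr0.le
    refine ⟨convex_univ, fun u _ v _ p q hp hq hpq => ?_⟩
    refine (Real.exp_le_exp.2 (h1.2 (Set.mem_univ u) (Set.mem_univ v) hp hq hpq)).trans ?_
    exact convexOn_exp.2 (Set.mem_univ _) (Set.mem_univ _) hp hq hpq
  have hmgf : ∫⁻ ω, ENNReal.ofReal (Real.exp (r * supportFun T (W ω))) ∂μ ≤
      ENNReal.ofReal (Real.exp (3 * (s * w + s ^ 2 * 2 ^ 2))) := by
    have h1 := h _ hconv (by fun_prop) fun v => (Real.exp_pos _).le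
    rw [lintegral_map (by fun_prop) hW, lintegral_map (by fun_prop) (by fun_prop)] at h1
    refine h1.trans ?_
    simp_rw [supportFun_smul hb.le, ← mul_assoc, hrb]
    rw [← ofReal_integral_eq_lintegral_ofReal (integrable_exp_supportFun hR h0 s)
      (Filter.Eventually.of_forall fun v => (Real.exp_pos _).le)]
    exact ENNReal.ofReal_le_ofReal (integral_exp_supportFun_le hR h0 hs0.le)
  have hmarkov := meas_ge_le_lintegral_div
    (f := fun ω => ENNReal.ofReal (Real.exp (r * supportFun T (W ω)))) (μ := μ)
    (by fun_prop) (ε := ENNReal.ofReal (Real.exp (r * τ)))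
    (by simpa using Real.exp_pos _) ENNReal.ofReal_ne_top
  calc μ {ω | τ < supportFun T (W ω)}
      ≤ μ {ω | ENNReal.ofReal (Real.exp (r * τ)) ≤
          ENNReal.ofReal (Real.exp (r * supportFun T (W ω)))} := by
        refine measure_mono fun ω hω => ENNReal.ofReal_le_ofReal (Real.exp_le_exp.2 ?_)
        exact mul_le_mul_of_nonneg_left (le_of_lt hω) hr0.le
    _ ≤ _ := hmarkov
    _ ≤ ENNReal.ofReal (Real.exp (3 * (s * w + s ^ 2 * 2 ^ 2))) /
          ENNReal.ofReal (Real.exp (r * τ)) := by gcongr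
    _ ≤ _ := by
        rw [← ENNReal.ofReal_div_of_pos (Real.exp_pos _), ← Real.exp_sub]
        refine ENNReal.ofReal_le_ofReal (Real.exp_le_exp.2 ?_)
        have : r * τ = s * (3 * w + 12 * β) := by rw [hτ, ← mul_assoc, hrb]
        rw [this, hs]
        nlinarith [sq_nonneg β]

section Ensemble

variable {Ω Ω' : Type*} {m n : ℕ} {a : Fin m → Ω → EuclideanSpace ℝ (Fin n)}

lemma objective_eq_inner {y : Fin m → Ω → ℝ} (ω : Ω)
    (z : EuclideanSpace ℝ (Fin n)) :
    objective a y z ω = (1 / (m : ℝ)) * inner ℝ (∑ i, y i ω • a i ω) z := by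
  simp [objective, sum_inner, real_inner_smul_left]

variable [MeasurableSpace Ω] [MeasurableSpace Ω'] {μ : Measure Ω} {P : Measure Ω'} {ξ : Ω' → ℝ}

lemma integral_objective {y : Fin m → Ω → ℝ}
    (hint : ∀ i, Integrable (fun ω => y i ω • a i ω) μ)
    (z : EuclideanSpace ℝ (Fin n)) :
    ∫ ω, objective a y z ω ∂μ =
      (1 / (m : ℝ)) * inner ℝ (∑ i, ∫ ω, y i ω • a i ω ∂μ) z := by
  simp_rw [objective_eq_inner, integral_const_mul]
  rw [← integral_finsetSum _ fun i _ => hint i]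
  congr 1
  have := (innerSL ℝ z).integral_comp_comm (integrable_finsetSum Finset.univ fun i _ => hint i)
  simpa only [innerSL_apply_apply, real_inner_comm] using this

lemma IsSubgaussianEnsemble.iIndepFun (ha : IsSubgaussianEnsemble μ P ξ a) :
    iIndepFun a μ := by
  have hm := ha.measurable
  have h := iIndepFun_curry (fun ij : Fin m × Fin n => by fun_prop) ha.indep
  exact h.comp (fun _ v => WithLp.toLp 2 v) fun _ => by fun_prop

lemma IsSubgaussianEnsemble.aemeasurable (ha : IsSubgaussianEnsemble μ P ξ a) :
    AEMeasurable ξ P := ha.symmetric.aemeasurable_fst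

lemma IsSubgaussianEnsemble.integrable (ha : IsSubgaussianEnsemble μ P ξ a) (i : Fin m) :
    Integrable (a i) μ := by
  have hξ : Integrable ξ P := by
    rw [← memLp_one_iff_integrable]
    refine ⟨ha.aemeasurable.aestronglyMeasurable, ?_⟩
    have := eLpNorm_le_subgaussianNorm ha.subgaussian (p := 1) le_rfl
    rw [ENNReal.ofReal_one] at this
    exact this.trans_lt ENNReal.ofReal_lt_top
  have hsum : Integrable (fun ω => ∑ j, a i ω j • EuclideanSpace.basisFun (Fin n) ℝ j) μ :=
    integrable_finsetSum _ fun j _ => ((ha.copies i j).integrable_iff.2 hξ).smul_const _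
  exact hsum.congr (Filter.Eventually.of_forall fun ω =>
    (EuclideanSpace.basisFun (Fin n) ℝ).sum_repr (a i ω))

variable [IsProbabilityMeasure P]

lemma IsSubgaussianEnsemble.toReal_pos (ha : IsSubgaussianEnsemble μ P ξ a) :
    0 < (subgaussianNorm ξ P).toReal :=
  subgaussianNorm_toReal_pos ha.aemeasurable ha.subgaussian ha.unit_variance

variable [IsProbabilityMeasure μ]

lemma IsSubgaussianEnsemble.convexLE (ha : IsSubgaussianEnsemble μ P ξ a) (i : Fin m) :
    ConvexLE (μ.map (a i)) ((stdGaussian (EuclideanSpace ℝ (Fin n))).map fun v =>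
      (27 * (Real.exp 1 * (subgaussianNorm ξ P).toReal)) • v) := by
  refine ConvexLE.of_coordinates (ha.measurable i)
    (ha.indep.precomp (g := fun j => (i, j)) fun j j' hj => (Prod.ext_iff.1 hj).2) fun j => ?_
  rw [(ha.copies i j).map_eq]
  simpa only [mul_assoc] using
    ConvexLE.of_subgaussianNorm ha.aemeasurable ha.symmetric ha.subgaussian ha.toReal_pos

variable {θ : ℝ → ℝ} {x : EuclideanSpace ℝ (Fin n)} {y : Fin m → Ω → ℝ}

lemma IsGLM.integrable_smul (hy : IsGLM μ a θ x y) (ha : IsSubgaussianEnsemble μ P ξ a)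
    (i : Fin m) : Integrable (fun ω => y i ω • a i ω) μ := by
  refine (ha.integrable i).mono ((hy.measurable i).smul (ha.measurable i)).aestronglyMeasurable
    (Filter.Eventually.of_forall fun ω => ?_)
  rcases hy.values i ω with h | h <;> simp [h]

lemma IsGLM.convexLE_sum_centered (hy : IsGLM μ a θ x y) (ha : IsSubgaussianEnsemble μ P ξ a)
    (hθ : Measurable θ) :
    ConvexLE (μ.map fun ω => ∑ i, (y i ω • a i ω - ∫ ω', y i ω' • a i ω' ∂μ))
      ((stdGaussian (EuclideanSpace ℝ (Fin n))).map fun v =>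
        (2 * (27 * (Real.exp 1 * (subgaussianNorm ξ P).toReal)) * √m) • v) := by
  set L := 27 * (Real.exp 1 * (subgaussianNorm ξ P).toReal) with hL
  set γ := stdGaussian (EuclideanSpace ℝ (Fin n)) with hγ
  have hym := hy.measurable
  have ham := ha.measurable
  have hsymm : (γ.map fun v => L • v).map (fun v => -v) = γ.map fun v => L • v := by
    conv_rhs => rw [hγ, ← stdGaussian_map_neg]
    rw [Measure.map_map (by fun_prop) (by fun_prop), Measure.map_map (by fun_prop) (by fun_prop)]
    congr 1
    ext1 v
    simp
  have heach : ∀ i, ConvexLE (μ.map fun ω => y i ω • a i ω - ∫ ω', y i ω' • a i ω' ∂μ)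
      ((Measure.pi fun _ : Fin m => γ).map fun g => (2 * L) • g i) := fun i => by
    have h1 := ConvexLE.centered_of_sign hsymm (ha.measurable i) (ha.integrable i) (ha.convexLE i)
      (hym i) (hy.values i)
    rw [Measure.map_map (by fun_prop) (by fun_prop),
      ← (measurePreserving_eval (fun _ : Fin m => γ) i).map_eq,
      Measure.map_map (by fun_prop) (by fun_prop)] at h1
    convert h1 using 2
    ext1 g
    simp [mul_smul]
  have hXi : iIndepFun (fun i ω => y i ω • a i ω - ∫ ω', y i ω' • a i ω' ∂μ) μ :=
    (hy.iIndepFun_prodMk ham hθ ha.iIndepFun).comp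
      (fun i p => p.2 • p.1 - ∫ ω', y i ω' • a i ω' ∂μ) fun i => by fun_prop
  have hYi : iIndepFun (fun (i : Fin m) (g : Fin m → EuclideanSpace ℝ (Fin n)) => (2 * L) • g i)
      (Measure.pi fun _ : Fin m => γ) :=
    iIndepFun_pi (X := fun _ v => (2 * L) • v) fun i => by fun_prop
  rw [← map_sum_stdGaussian]
  exact ConvexLE.sum (fun i => by fun_prop) (fun i => by fun_prop) hXi hYi heach Finset.univ

end Ensemble

end OneBit

/-! ### The recovery bound -/

theorem lemma2p2 :
    ∃ C : ℝ, 0 < C ∧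
      ∀ {Ω Ω' : Type*} [MeasurableSpace Ω] [MeasurableSpace Ω']
        (μ : Measure Ω) [IsProbabilityMeasure μ] (P : Measure Ω') [IsProbabilityMeasure P]
        (m n : ℕ) (_hm : 0 < m)
        (ξ : Ω' → ℝ) (a : Fin m → Ω → EuclideanSpace ℝ (Fin n))
        (_ha : OneBit.IsSubgaussianEnsemble μ P ξ a)
        (K : Set (EuclideanSpace ℝ (Fin n))) (_hK : K ⊆ Metric.closedBall 0 1)
        (x : EuclideanSpace ℝ (Fin n)) (_hxK : x ∈ K) (_hx : ‖x‖ = 1)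
        (θ : ℝ → ℝ) (_hθ : Measurable θ) (_hθ1 : ∀ t, θ t ∈ Set.Icc (-1 : ℝ) 1)
        (_hlam : 0 < OneBit.corr θ)
        (y : Fin m → Ω → ℝ) (_hy : OneBit.IsGLM μ a θ x y)
        (α : ℝ) (_hα : 0 < α)
        (_hbound : ∀ x' ∈ K,
          |(∫ ω, OneBit.objective a y x' ω ∂μ) - OneBit.corr θ * inner ℝ x x'| ≤ α)
        (β : ℝ) (_hβ : 0 < β),
        ∃ G : Set Ω, MeasurableSet G ∧ 1 - 4 * Real.exp (-β ^ 2) ≤ μ.real G ∧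
          ∀ ω ∈ G, ∀ xhat : EuclideanSpace ℝ (Fin n), OneBit.IsSolution a y K ω xhat →
            ‖xhat - x‖ ^ 2 ≤ 4 * α / OneBit.corr θ +
              C * (OneBit.subgaussianNorm ξ P).toReal *
                ((OneBit.meanWidth K + β) / (OneBit.corr θ * Real.sqrt m)) := by
  -- The final error term is `4 L (3 w + 12 β) ≤ 48 L (w + β)` over `λ √m`, with `L = 27 e κ`.
  refine ⟨48 * (27 * Real.exp 1), by positivity, ?_⟩
  intro Ω Ω' _ _ μ _ P _ m n hm ξ a ha K hK x hxK hx θ hθ _ hlam y hy α _ hbound β hβ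
  set κ := (OneBit.subgaussianNorm ξ P).toReal with hκ
  have hκ0 : 0 < κ := ha.toReal_pos
  set L := 27 * (Real.exp 1 * κ) with hL
  have hL0 : 0 < L := by positivity
  have hm0 : (0 : ℝ) < m := by exact_mod_cast hm
  have hR : ∀ z ∈ K - K, ‖z‖ ≤ 2 := by
    rintro _ ⟨u, hu, v, hv, rfl⟩
    have h1 := mem_closedBall_zero_iff.1 (hK hu)
    have h2 := mem_closedBall_zero_iff.1 (hK hv)
    exact (norm_sub_le u v).trans (by linarith)
  have h0 : (0 : EuclideanSpace ℝ (Fin n)) ∈ K - K := ⟨x, hxK, x, hxK, sub_self x⟩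
  set V : Fin m → Ω → EuclideanSpace ℝ (Fin n) := fun i ω => y i ω • a i ω with hV
  set W : Ω → EuclideanSpace ℝ (Fin n) := fun ω => ∑ i, (V i ω - ∫ ω', V i ω' ∂μ) with hW
  have hVm : ∀ i, Measurable (V i) := fun i => (hy.measurable i).smul (ha.measurable i)
  have hWm : Measurable W := by fun_prop
  set w := OneBit.meanWidth K with hw
  have hw0 : 0 ≤ w := integral_nonneg fun v => OneBit.supportFun_nonneg hR h0 v
  set τ := 2 * L * √m * (3 * w + 12 * β) with hτ
  have hF := OneBit.continuous_supportFun hR h0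
  have hGm : MeasurableSet {ω | OneBit.supportFun (K - K) (W ω) ≤ τ} :=
    measurableSet_le (by fun_prop) measurable_const
  -- A single event controls all feasible directions at once. Its complement has probability at most
  -- `exp (-β²)`, so the factor 4 is not needed.
  refine ⟨{ω | OneBit.supportFun (K - K) (W ω) ≤ τ}, hGm, ?_, ?_⟩
  · have htail : μ {ω | τ < OneBit.supportFun (K - K) (W ω)} ≤
        ENNReal.ofReal (Real.exp (-β ^ 2)) :=
      OneBit.measure_lt_supportFun_le hWm (by positivity) (hy.convexLE_sum_centered ha hθ)
        hR h0 hβ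
    have hcompl : {ω | OneBit.supportFun (K - K) (W ω) ≤ τ}ᶜ =
        {ω | τ < OneBit.supportFun (K - K) (W ω)} := by
      ext ω; simp
    have h1 := ENNReal.toReal_mono ENNReal.ofReal_ne_top htail
    rw [ENNReal.toReal_ofReal (Real.exp_pos _).le, ← hcompl] at h1
    have h2 := probReal_compl_eq_one_sub (μ := μ) hGm
    rw [measureReal_def] at h2
    have := Real.exp_pos (-β ^ 2)
    linarith
  · intro ω hω xhat hsol
    have hint : ∀ i, Integrable (V i) μ := hy.integrable_smul ha
    have hdev : inner ℝ (W ω) (xhat - x) ≤ τ :=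
      (OneBit.inner_le_supportFun hR (W ω) ⟨xhat, hsol.1, x, hxK, rfl⟩).trans hω
    have hmax : OneBit.objective a y x ω ≤ OneBit.objective a y xhat ω :=
      mul_le_mul_of_nonneg_left (hsol.2 hxK) (by positivity)
    have hWe : inner ℝ (W ω) (xhat - x) = m * (OneBit.objective a y xhat ω -
        OneBit.objective a y x ω - ((∫ ω', OneBit.objective a y xhat ω' ∂μ) -
          ∫ ω', OneBit.objective a y x ω' ∂μ)) := by
      rw [OneBit.integral_objective hint, OneBit.integral_objective hint,
        OneBit.objective_eq_inner, OneBit.objective_eq_inner, hW]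
      simp only [Finset.sum_sub_distrib, inner_sub_left, inner_sub_right, hV]
      field_simp
      ring
    have b1 := abs_le.1 (hbound x hxK)
    have b2 := abs_le.1 (hbound xhat hsol.1)
    rw [real_inner_self_eq_norm_sq, hx] at b1
    have hexp : (∫ ω', OneBit.objective a y x ω' ∂μ) -
        ∫ ω', OneBit.objective a y xhat ω' ∂μ ≤ τ / m := by
      rw [le_div_iff₀ hm0]
      rw [hWe] at hdev
      nlinarith
    have hlin : OneBit.corr θ * (1 - inner ℝ x xhat) ≤ 2 * α + τ / m := by
      linarith [b1.1, b2.2]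
    have hnx : ‖xhat‖ ≤ 1 := mem_closedBall_zero_iff.1 (hK hsol.1)
    have hsq : ‖xhat - x‖ ^ 2 ≤ 2 * (1 - inner ℝ x xhat) := by
      rw [norm_sub_sq_real, hx, real_inner_comm]
      nlinarith [norm_nonneg xhat]
    have hdiv : 1 - inner ℝ x xhat ≤ (2 * α + τ / m) / OneBit.corr θ := by
      rw [le_div_iff₀' hlam]
      exact hlin
    have hτm : τ / m = 2 * L * (3 * w + 12 * β) / √m := by
      rw [hτ, div_eq_div_iff hm0.ne' (Real.sqrt_pos.2 hm0).ne']
      linear_combination (2 * L * (3 * w + 12 * β)) * Real.mul_self_sqrt hm0.le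
    calc ‖xhat - x‖ ^ 2 ≤ 2 * ((2 * α + τ / m) / OneBit.corr θ) := by linarith
      _ = 4 * α / OneBit.corr θ +
          4 * L * (3 * w + 12 * β) / (OneBit.corr θ * √m) := by
        rw [hτm]; field_simp; ring
      _ ≤ 4 * α / OneBit.corr θ + 4 * L * (12 * (w + β)) / (OneBit.corr θ * √m) := by
        gcongr
        linarith
      _ = _ := by rw [hL]; ring
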